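/- Let $k$ be a field, let $H$ be a finite dimensional Hopf algebra over $k$ with comultiplication $\Delta$ and counit $\epsilon$, and let $A\neq 0$ be a right $H$-comodule algebra, i.e. an associative unital $k$-algebra with a coassociative, counital algebra map $\delta:A\to A\otimes_k H$, $\delta(a)=a_{(0)}\otimes a_{(1)}$. Put $A^{co\,H}=\{a\in A:\delta(a)=a\otimes 1\}$ and assume that $A^{co\,H}\subseteq A$ is an $H$-Hopf--Galois extension, i.e. that $$\mathit{can}:A\otimes_{A^{co\,H}}A\to A\otimes_k H,\qquad a\otimes b\mapsto a\,b_{(0)}\otimes b_{(1)}$$ is bijective. Let $\mathsf{Quot}_{gen}(H)$ be the poset of quotients $Q=H/I$ of $H$ by right ideals $I$ which are also coideals, where $H/I\le H/J$ means $J\subseteq I$. For $Q=H/I$ with projection $\pi:H\to Q$ let $A^{co\,Q}=\{a\in A: a_{(0)}\otimes\pi(a_{(1)})=a\otimes\pi(1)\}$, a subalgebra of $A$ containing $A^{co\,H}$. Let $\mathsf{Sub}_{alg}(A/A^{co\,H})$ be the poset, under inclusion, of the subalgebras of $A$ that contain $A^{co\,H}$, and let $\mathsf{Sub}_{H\text{-}ext}(A^{co\,H}\subseteq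 A)$ be its subposet consisting of the subalgebras of the form $A^{co\,Q}$ with $Q\in\mathsf{Quot}_{gen}(H)$ (the intermediate $H$-extensions $A^{co\,Q}\subseteq A$). Then: 1. For every $Q\in\mathsf{Quot}_{gen}(H)$ the extension $A^{co\,Q}\subseteq A$ is $Q$-Galois, i.e. the canonical map $\mathit{can}_Q:A\otimes_{A^{co\,Q}}A\to A\otimes_k Q$, $a\otimes b\mapsto a\,b_{(0)}\otimes\pi(b_{(1)})$, is bijective. 2. The map $\phi:\mathsf{Quot}_{gen}(H)\to\mathsf{Sub}_{alg}(A/A^{co\,H})$, $\phi(Q)=A^{co\,Q}$, is part of an (order reversing) Galois connection $(\phi,\psi)$, that is, there is a map $\psi:\mathsf{Sub}_{alg}(A/A^{co\,H})\to\mathsf{Quot}_{gen}(H)$ with $A'\subseteq\phi(Q)\iff Q\le\psi(A')$ for all $A'$ and $Q$; and $\phi$ and the restriction of $\psi$ are mutually inverse anti-isomorphisms of posets $$\mathsf{Quot}_{gen}(H)\;\simeq\;\mathsf{Sub}_{H\text{-}ext}(A^{co\,H}\subseteq A).$$ -/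

import Mathlib

open scoped TensorProduct

namespace HopfGalois

section ComoduleAlgebra

/-- A right `H`-comodule algebra structure on `A`: a coassociative and counital algebra map
`δ : A → A ⊗ H`. -/
structure ComoduleAlgebra (k H A : Type*) [Field k] [Ring H] [HopfAlgebra k H]
    [Ring A] [Algebra k A] where
  /-- the coaction `δ` -/
  coact : A →ₐ[k] A ⊗[k] H
  /-- `(δ ⊗ id) ∘ δ = (id ⊗ Δ) ∘ δ` -/
  coassoc : (TensorProduct.assoc k A H H).toLinearMap ∘ₗ
      coact.toLinearMap.rTensor H ∘ₗ coact.toLinearMap =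
    (Coalgebra.comul (R := k) (A := H)).lTensor A ∘ₗ coact.toLinearMap
  /-- `(id ⊗ ε) ∘ δ = id` -/
  counital : (TensorProduct.rid k A).toLinearMap ∘ₗ
      (Coalgebra.counit (R := k) (A := H)).lTensor A ∘ₗ coact.toLinearMap = LinearMap.id

end ComoduleAlgebra

section GenQuot

/-- The set `Quot_gen(H)` of generalised quotients `Q = H / I` of `H`, each given by the coideal
right ideal `I` which determines it. -/
@[ext]
structure GenQuot (k H : Type*) [Field k] [Ring H] [HopfAlgebra k H] where
  /-- the kernel `I` of the projection `H → H / I` -/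
  ker : Submodule k H
  /-- `I` is a coideal -/
  isCoideal : ker.IsCoideal
  /-- `I` is a right ideal -/
  mul_mem : ∀ ⦃x : H⦄, x ∈ ker → ∀ h : H, x * h ∈ ker

variable {k H : Type*} [Field k] [Ring H] [HopfAlgebra k H]

/-- The order of quotients: `H / I ≤ H / J` iff `J ⊆ I`, i.e. iff the projection `H → H / I` factors
through `H → H / J`. -/
instance : PartialOrder (GenQuot k H) where
  le Q Q' := Q'.ker ≤ Q.ker
  le_refl Q := le_refl Q.ker
  le_trans _ _ _ h h' := le_trans h' h
  le_antisymm _ _ h h' := GenQuot.ext (le_antisymm h' h)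

/-- The quotient space `Q = H / I`. -/
abbrev GenQuot.Quotient (Q : GenQuot k H) : Type _ := H ⧸ Q.ker

/-- `Q = H / I` is a coalgebra. -/
instance (Q : GenQuot k H) : Coalgebra k Q.Quotient :=
  haveI := Q.isCoideal
  inferInstance

/-- The projection `π : H → Q`. -/
abbrev GenQuot.proj (Q : GenQuot k H) : H →ₗ[k] Q.Quotient := Q.ker.mkQ

end GenQuot

section BalancedTensor

variable {k A : Type*} [Field k] [Ring A] [Algebra k A]

/-- The subspace of `A ⊗ₖ A` spanned by the elements `ab ⊗ c - a ⊗ bc` with `a, c ∈ A`,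
`b ∈ B`. -/
def balancedRel (B : Subalgebra k A) : Submodule k (A ⊗[k] A) :=
  Submodule.span k {x | ∃ a c : A, ∃ b ∈ B, x = (a * b) ⊗ₜ[k] c - a ⊗ₜ[k] (b * c)}

/-- The tensor product `A ⊗_B A` over a (possibly noncommutative) subalgebra `B` of `A`. -/
abbrev BalancedTensor (B : Subalgebra k A) : Type _ := (A ⊗[k] A) ⧸ balancedRel B

end BalancedTensor

namespace ComoduleAlgebra

variable {k H A : Type*} [Field k] [Ring H] [HopfAlgebra k H] [Ring A] [Algebra k A]
  (δ : ComoduleAlgebra k H A)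

/-- The subalgebra of coinvariants `A^{co H} = {a | δ(a) = a ⊗ 1}`. -/
def coinv : Subalgebra k A := AlgHom.equalizer δ.coact Algebra.TensorProduct.includeLeft

theorem mem_coinv {a : A} : a ∈ δ.coinv ↔ δ.coact a = a ⊗ₜ[k] (1 : H) := Iff.rfl

/-- The map `δ_Q = (id ⊗ π) ∘ δ : A → A ⊗ Q`. -/
def coactQuot (Q : GenQuot k H) : A →ₗ[k] A ⊗[k] Q.Quotient :=
  Q.proj.lTensor A ∘ₗ δ.coact.toLinearMap

/-- The `k`-linear map `A ⊗ₖ A → A ⊗ H`, `a ⊗ b ↦ (a ⊗ 1) δ(b) = a b₀ ⊗ b₁`. -/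
def preCan : A ⊗[k] A →ₗ[k] A ⊗[k] H :=
  LinearMap.mul' k (A ⊗[k] H) ∘ₗ
    TensorProduct.map (Algebra.TensorProduct.includeLeft (R := k) (S := k)).toLinearMap
      δ.coact.toLinearMap

@[simp]
theorem preCan_tmul (a b : A) :
    δ.preCan (a ⊗ₜ[k] b) = (a ⊗ₜ[k] (1 : H)) * δ.coact b := rfl

/-- Right multiplication of `x ∈ A ⊗ H` by a fixed element preserves the kernel of `id ⊗ π`,
because `I` is a right ideal. -/
theorem lTensor_proj_mul_congr (Q : GenQuot k H) {x y : A ⊗[k] H}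
    (h : Q.proj.lTensor A x = Q.proj.lTensor A y) (z : A ⊗[k] H) :
    Q.proj.lTensor A (x * z) = Q.proj.lTensor A (y * z) := by
  induction z with
  | zero => simp
  | add z w hz hw => simp only [mul_add, map_add, hz, hw]
  | tmul c g =>
    have hle : Q.ker ≤ Q.ker.comap (LinearMap.mulRight k g) := fun x hx => Q.mul_mem hx g
    have key : Q.proj.lTensor A ∘ₗ LinearMap.mulRight k (c ⊗ₜ[k] g) =
        TensorProduct.map (LinearMap.mulRight k c) (Q.ker.mapQ Q.ker _ hle) ∘ₗ
          Q.proj.lTensor A := by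
      ext a b
      simp
    have hx := LinearMap.congr_fun key x
    have hy := LinearMap.congr_fun key y
    simp only [LinearMap.comp_apply, LinearMap.mulRight_apply] at hx hy
    rw [hx, hy, h]

theorem coactQuot_mul (Q : GenQuot k H) {a : A}
    (ha : δ.coactQuot Q a = a ⊗ₜ[k] Q.proj 1) (b : A) :
    δ.coactQuot Q (a * b) = Q.proj.lTensor A ((a ⊗ₜ[k] (1 : H)) * δ.coact b) := by
  have h : Q.proj.lTensor A (δ.coact a) = Q.proj.lTensor A (a ⊗ₜ[k] (1 : H)) := by
    simpa [coactQuot] using ha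
  simpa [coactQuot] using lTensor_proj_mul_congr Q h (δ.coact b)

theorem lTensor_proj_tmul_one_mul (Q : GenQuot k H) (a : A) {x y : A ⊗[k] H}
    (h : Q.proj.lTensor A x = Q.proj.lTensor A y) :
    Q.proj.lTensor A ((a ⊗ₜ[k] (1 : H)) * x) = Q.proj.lTensor A ((a ⊗ₜ[k] (1 : H)) * y) := by
  have key : Q.proj.lTensor A ∘ₗ LinearMap.mulLeft k (a ⊗ₜ[k] (1 : H)) =
      (LinearMap.mulLeft k a).rTensor Q.Quotient ∘ₗ Q.proj.lTensor A := by
    ext b c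
    simp
  have hx := LinearMap.congr_fun key x
  have hy := LinearMap.congr_fun key y
  simp only [LinearMap.comp_apply, LinearMap.mulLeft_apply] at hx hy
  rw [hx, hy, h]

/-- The subalgebra of `Q`-coinvariants `A^{co Q} = {a | (id ⊗ π) δ(a) = a ⊗ π(1)}`. -/
def coinvQuot (Q : GenQuot k H) : Subalgebra k A where
  carrier := {a | δ.coactQuot Q a = a ⊗ₜ[k] Q.proj 1}
  add_mem' := by
    intro a b ha hb
    simp only [Set.mem_ofPred_eq] at ha hb ⊢
    rw [map_add, ha, hb, TensorProduct.add_tmul]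
  mul_mem' := by
    intro a b ha hb
    simp only [Set.mem_ofPred_eq] at ha hb ⊢
    have h : Q.proj.lTensor A (δ.coact b) = Q.proj.lTensor A (b ⊗ₜ[k] (1 : H)) := by
      simpa [coactQuot] using hb
    rw [δ.coactQuot_mul Q ha b, lTensor_proj_tmul_one_mul Q a h]
    simp
  algebraMap_mem' := by
    intro r
    simp [coactQuot, Algebra.TensorProduct.algebraMap_apply]

theorem mem_coinvQuot (Q : GenQuot k H) {a : A} :
    a ∈ δ.coinvQuot Q ↔ δ.coactQuot Q a = a ⊗ₜ[k] Q.proj 1 := Iff.rfl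

theorem coinv_le_coinvQuot (Q : GenQuot k H) : δ.coinv ≤ δ.coinvQuot Q := by
  intro a ha
  rw [mem_coinv] at ha
  simp [mem_coinvQuot, coactQuot, ha]

/-- The canonical map `can : A ⊗_{A^{co H}} A → A ⊗ H`, `a ⊗ b ↦ a b₀ ⊗ b₁`. -/
def can : BalancedTensor δ.coinv →ₗ[k] A ⊗[k] H :=
  (balancedRel δ.coinv).liftQ δ.preCan <| by
    rw [balancedRel, Submodule.span_le]
    rintro _ ⟨a, c, b, hb, rfl⟩
    rw [mem_coinv] at hb
    simp [hb, ← mul_assoc]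

/-- The canonical map `can_Q : A ⊗_{A^{co Q}} A → A ⊗ Q`, `a ⊗ b ↦ a b₀ ⊗ π(b₁)`. -/
def canQuot (Q : GenQuot k H) : BalancedTensor (δ.coinvQuot Q) →ₗ[k] A ⊗[k] Q.Quotient :=
  (balancedRel (δ.coinvQuot Q)).liftQ (Q.proj.lTensor A ∘ₗ δ.preCan) <| by
    rw [balancedRel, Submodule.span_le]
    rintro _ ⟨a, c, b, hb, rfl⟩
    have h : Q.proj.lTensor A (δ.coact (b * c)) =
        Q.proj.lTensor A ((b ⊗ₜ[k] (1 : H)) * δ.coact c) := by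
      simpa [coactQuot] using δ.coactQuot_mul Q hb c
    have h' := lTensor_proj_tmul_one_mul Q a h
    rw [← mul_assoc, Algebra.TensorProduct.tmul_mul_tmul, one_mul] at h'
    rw [SetLike.mem_coe, LinearMap.mem_ker, map_sub, LinearMap.comp_apply, LinearMap.comp_apply,
      preCan_tmul, preCan_tmul, h', sub_self]

/-- `A^{co H} ⊆ A` is an `H`-Hopf–Galois extension: the canonical map is bijective. -/
def IsHopfGalois : Prop := Function.Bijective δ.can

/-- `A^{co Q} ⊆ A` is `Q`-Galois: the canonical map `can_Q` is bijective. -/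
def IsQuotGalois (Q : GenQuot k H) : Prop := Function.Bijective (δ.canQuot Q)

/-- The poset `Sub_alg(A / A^{co H})` of all subalgebras of `A` containing `A^{co H}`, ordered by
inclusion. -/
abbrev SubAlg : Type _ := Set.Ici δ.coinv

/-- The map `φ : Quot_gen(H) → Sub_alg(A / A^{co H})`, `Q ↦ A^{co Q}`. -/
def phi (Q : GenQuot k H) : δ.SubAlg := ⟨δ.coinvQuot Q, δ.coinv_le_coinvQuot Q⟩

/-- The poset `Sub_{H-ext}(A^{co H} ⊆ A)` of intermediate `H`-extensions, i.e. of the intermediate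
subalgebras of the form `A^{co Q}` with `Q ∈ Quot_gen(H)`, ordered by inclusion. -/
abbrev SubHExt : Type _ := {S : δ.SubAlg // ∃ Q : GenQuot k H, S.1 = δ.coinvQuot Q}

end ComoduleAlgebra

end HopfGalois

/-! Everything rests on one fact: for `Q = H / I`, the dual `Q*` contains a left integral `t` and
`H` an element `h` with `t(x S(h)) = ε(x)` for all `x` (`exists_integral_translate_eq_counit`).

Given this, `a ↦ a₀ t(a₁)` maps `A` into `A^{co Q}`. Choose `∑ xᵢ ⊗ yᵢ` with image `1 ⊗ h` under
`can`; then `∑ ((y xᵢ)₀ t((y xᵢ)₁)) yᵢ = y` for every `y`. Moving the coinvariant factors across the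
balanced tensor rewrites `x ⊗ y` as `∑ x (y xᵢ)₀ t((y xᵢ)₁) ⊗ yᵢ`, which depends only on `can(x ⊗
y)`, and vanishes for tensors killed by `can_Q` because `t` factors through `Q`. So `can_Q` is
injective; it is surjective because `can` is. Since `I` can be read off from the kernel of `can_Q`,
which is generated by `A^{co Q}`, the map `φ` reflects the order. The adjoint `ψ` sends `S` to the
quotient by the right ideal generated by all `f(a₀) a₁ - f(a)`, `a ∈ S`, and a Galois connection
with `φ` order reflecting gives `ψ φ = id`.

The fact about integrals comes from a counting argument. For an `H`-module algebra `K` and a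
`K`-module `N` with a compatible twisted `H`-action, maximise `dim Hom_K(W, N) / dim W`. Maximality
passes to submodules, quotients, powers and to `Hom(H, W)`. If no nonzero stable ideal kills a
nonzero element of `N`, then `Hom(H, W)` is faithful, so `K` embeds in a power of it and is itself
extremal; hence so is each `K / L`, and every proper left ideal `L` kills some `n ≠ 0`. This is used
three times: for `H*`, giving an integral and then bijectivity of the antipode; for `Q*` acting on
`H`, showing that `Q*` has no proper nonzero stable left ideals; for `Q*` acting on itself, giving
`t`. The translates `S(h) t` then form a nonzero stable left ideal, which must contain `ε`. -/

namespace HopfGalois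

open Coalgebra HopfAlgebra Module WithConv

/-! ### Sweedler calculus with explicit coproduct expansions -/

section Sweedler

variable {k C M : Type*} [Field k] [AddCommGroup C] [Module k C] [Coalgebra k C]
  [AddCommGroup M] [Module k M]

/-- `T` is a bare function with separate linearity hypotheses, so that any expression trilinear in
Sweedler components can be inserted as a lambda term. -/
theorem sum_coassoc {ι : Type*} {c : C} (r : Repr k c ι) (T : C → C → C → M)
    (h₁ : ∀ y z, IsLinearMap k fun x => T x y z) (h₂ : ∀ x z, IsLinearMap k fun y => T x y z)
    (h₃ : ∀ x y, IsLinearMap k fun z => T x y z) :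
    ∑ i ∈ r.index, ∑ j ∈ (ℛ k (r.left i)).index,
        T ((ℛ k (r.left i)).left j) ((ℛ k (r.left i)).right j) (r.right i) =
      ∑ i ∈ r.index, ∑ j ∈ (ℛ k (r.right i)).index,
        T (r.left i) ((ℛ k (r.right i)).left j) ((ℛ k (r.right i)).right j) := by
  let T' : C →ₗ[k] C →ₗ[k] C →ₗ[k] M :=
    LinearMap.mk₂ k (fun x y => (h₃ x y).mk')
      (fun x y z => by ext c; exact (h₁ z c).map_add x y)
      (fun a x y => by ext c; exact (h₁ y c).map_smul a x)
      (fun x y z => by ext c; exact (h₂ x c).map_add y z)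
      (fun a x y => by ext c; exact (h₂ x c).map_smul a y)
  have h := congrArg (TensorProduct.lift ((TensorProduct.lift.equiv (.id k) C C M).toLinearMap ∘ₗ T'))
    (sum_tmul_tmul_eq r (fun i => ℛ k (r.left i)) (fun i => ℛ k (r.right i)))
  simpa [T'] using h

theorem sum_counit_smul_map {ι : Type*} {c : C} (r : Repr k c ι) (f : C →ₗ[k] M) :
    ∑ i ∈ r.index, counit (R := k) (r.left i) • f (r.right i) = f c := by
  conv_rhs => rw [← sum_counit_smul r]
  simp

theorem sum_smul_counit_map {ι : Type*} {c : C} (r : Repr k c ι) (f : C →ₗ[k] M) :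
    ∑ i ∈ r.index, counit (R := k) (r.right i) • f (r.left i) = f c := by
  have h := congrArg (TensorProduct.rid k C) (sum_tmul_counit_eq r)
  simp only [map_sum, TensorProduct.rid_tmul, one_smul] at h
  conv_rhs => rw [← h]
  simp

end Sweedler

/-! ### Module algebras and the twisted modules `Hom(H, W)` -/

/-- A left `H`-module algebra structure on `K`. -/
structure ModuleAlg (k H K : Type*) [Field k] [Ring H] [HopfAlgebra k H] [Ring K]
    [Algebra k K] where
  /-- the action of `H` on `K` -/
  act : H →ₐ[k] Module.End k K
  act_mul : ∀ (p : H) (u v : K), act p (u * v) =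
    ∑ i ∈ (ℛ k p).index, act ((ℛ k p).left i) u * act ((ℛ k p).right i) v
  act_one : ∀ p : H, act p 1 = counit (R := k) p • (1 : K)

namespace ModuleAlg

variable {k H K : Type*} [Field k] [Ring H] [HopfAlgebra k H] [Ring K] [Algebra k K]

/-- The space `Hom(H, W)` for a `K`-module `W`, with the `K`-module structure
`(u φ)(p) = ∑ (p₁ u) φ(p₂)`. -/
@[nolint unusedArguments]
def Twist (_ : ModuleAlg k H K) (W : Type*) [AddCommGroup W] [Module k W] : Type _ :=
  H →ₗ[k] W

variable (D : ModuleAlg k H K) {W : Type*} [AddCommGroup W] [Module k W]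

instance : AddCommGroup (D.Twist W) := inferInstanceAs (AddCommGroup (H →ₗ[k] W))

instance : Module k (D.Twist W) := inferInstanceAs (Module k (H →ₗ[k] W))

instance : FunLike (D.Twist W) H W := inferInstanceAs (FunLike (H →ₗ[k] W) H W)

instance : LinearMapClass (D.Twist W) k H W := inferInstanceAs (LinearMapClass (H →ₗ[k] W) k H W)

@[ext] theorem Twist.ext {φ χ : D.Twist W} (h : ∀ p, φ p = χ p) : φ = χ := LinearMap.ext h

@[simp] theorem Twist.add_apply (φ χ : D.Twist W) (p : H) : (φ + χ) p = φ p + χ p := rfl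

@[simp] theorem Twist.smul_apply' (a : k) (φ : D.Twist W) (p : H) : (a • φ) p = a • φ p := rfl

@[simp] theorem Twist.zero_apply (p : H) : (0 : D.Twist W) p = 0 := rfl

instance [FiniteDimensional k H] [FiniteDimensional k W] : FiniteDimensional k (D.Twist W) :=
  inferInstanceAs (FiniteDimensional k (H →ₗ[k] W))

theorem finrank_twist [FiniteDimensional k H] [FiniteDimensional k W] :
    Module.finrank k (D.Twist W) = Module.finrank k H * Module.finrank k W :=
  Module.finrank_linearMap k k H W

/-- The element `p ↦ λ(p) w` of `Hom(H, W)`. -/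
def Twist.single (l : H →ₗ[k] k) (w : W) : D.Twist W := l.smulRight w

@[simp] theorem Twist.single_apply (l : H →ₗ[k] k) (w : W) (p : H) :
    Twist.single D l w p = l p • w := rfl

variable [Module K W] [IsScalarTower k K W]

instance : SMul K (D.Twist W) where
  smul u φ := (TensorProduct.lift
    ((Algebra.lsmul k k W).toLinearMap.compl₁₂ (D.act.toLinearMap.flip u)
      (show H →ₗ[k] W from φ)) ∘ₗ comul : H →ₗ[k] W)

theorem Twist.smul_apply {ι : Type*} (u : K) (φ : D.Twist W) {p : H} (r : Repr k p ι) :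
    (u • φ) p = ∑ i ∈ r.index, D.act (r.left i) u • φ (r.right i) := by
  change TensorProduct.lift _ (comul p) = _
  rw [← r.eq, map_sum]
  rfl

instance : Module K (D.Twist W) where
  one_smul φ := by
    ext p
    rw [Twist.smul_apply D 1 φ (ℛ k p)]
    simp only [D.act_one, smul_assoc, one_smul]
    exact sum_counit_smul_map (ℛ k p) (show H →ₗ[k] W from φ)
  mul_smul u v φ := by
    ext p
    rw [Twist.smul_apply D _ φ (ℛ k p), Twist.smul_apply D u _ (ℛ k p)]
    simp only [D.act_mul, Finset.sum_smul, Twist.smul_apply D v φ (ℛ k _), Finset.smul_sum,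
      ← mul_smul]
    refine sum_coassoc (ℛ k p) (fun x y z => (D.act x u * D.act y v) • φ z) ?_ ?_ ?_
    · intro y z
      constructor <;> intros <;> simp [add_mul, add_smul]
    · intro x z
      constructor <;> intros <;> simp [mul_add, add_smul]
    · intro x y
      exact ⟨fun _ _ => by simp, fun a z => by rw [map_smul, smul_comm]⟩
  smul_zero u := by
    ext p
    simp [Twist.smul_apply D u 0 (ℛ k p)]
  smul_add u φ χ := by
    ext p
    simp [Twist.smul_apply D u _ (ℛ k p), Finset.sum_add_distrib]
  add_smul u v φ := by
    ext p
    simp [Twist.smul_apply D _ φ (ℛ k p), Finset.sum_add_distrib, add_smul]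
  zero_smul φ := by
    ext p
    simp [Twist.smul_apply D 0 φ (ℛ k p)]

instance : IsScalarTower k K (D.Twist W) where
  smul_assoc a u φ := by
    ext p
    simp [Twist.smul_apply D _ φ (ℛ k p), Finset.smul_sum]

/-- Evaluating on the functions `p ↦ ε(p) w` isolates `(p u) w`. This description makes the
annihilator visibly `H`-stable. -/
theorem mem_annihilator_twist {u : K} :
    u ∈ Module.annihilator K (D.Twist W) ↔ ∀ (p : H) (w : W), D.act p u • w = 0 := by
  rw [Module.mem_annihilator]
  constructor
  · intro h p w
    have h' := DFunLike.congr_fun (h (Twist.single D counit w)) p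
    rw [Twist.smul_apply D u _ (ℛ k p)] at h'
    simp only [Twist.single_apply, Twist.zero_apply] at h'
    rw [← h']
    refine (sum_smul_counit_map (ℛ k p) ((Algebra.lsmul k k W).toLinearMap.flip w ∘ₗ
      D.act.toLinearMap.flip u)).symm.trans ?_
    exact Finset.sum_congr rfl fun i _ => smul_comm _ _ _
  · intro h φ
    ext p
    simp [Twist.smul_apply D u φ (ℛ k p), h]

end ModuleAlg

/-! ### Subadditivity of `dim Hom_K(-, N)` -/

section HomDim

variable (k K : Type*) [Field k] [Ring K] [Algebra k K]

instance finiteDimensional_hom (W N : Type*) [AddCommGroup W] [Module k W] [Module K W]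
    [IsScalarTower k K W] [AddCommGroup N] [Module k N] [Module K N] [IsScalarTower k K N]
    [FiniteDimensional k W] [FiniteDimensional k N] : FiniteDimensional k (W →ₗ[K] N) :=
  FiniteDimensional.of_injective (LinearMap.restrictScalarsₗ k K W N k)
    (LinearMap.restrictScalars_injective k)

theorem finiteDimensional_submodule {W : Type*} [AddCommGroup W] [Module k W] [Module K W]
    [IsScalarTower k K W] [FiniteDimensional k W] (S : Submodule K W) : FiniteDimensional k S :=
  inferInstanceAs (FiniteDimensional k (S.restrictScalars k))

/-- The `k`-dimension of `Hom_K(W, N)`. -/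
noncomputable def homDim (W N : Type*) [AddCommGroup W] [Module k W] [Module K W]
    [IsScalarTower k K W] [AddCommGroup N] [Module k N] [Module K N] [IsScalarTower k K N] : ℕ :=
  finrank k (W →ₗ[K] N)

variable {W W' N : Type*} [AddCommGroup W] [Module k W] [Module K W] [IsScalarTower k K W]
  [AddCommGroup W'] [Module k W'] [Module K W'] [IsScalarTower k K W']
  [AddCommGroup N] [Module k N] [Module K N] [IsScalarTower k K N]

/-- Precomposition with a `K`-linear map, as a `k`-linear map. -/
def precomp (N : Type*) [AddCommGroup N] [Module k N] [Module K N] [IsScalarTower k K N]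
    (g : W →ₗ[K] W') : (W' →ₗ[K] N) →ₗ[k] (W →ₗ[K] N) where
  toFun f := f ∘ₗ g
  map_add' _ _ := rfl
  map_smul' _ _ := rfl

theorem homDim_le_of_surjective [FiniteDimensional k W] [FiniteDimensional k N] (g : W →ₗ[K] W') (hg : Function.Surjective g) :
    homDim k K W' N ≤ homDim k K W N := by
  refine LinearMap.finrank_le_finrank_of_injective (f := precomp k K N g) fun f f' h => ?_
  ext w
  obtain ⟨w, rfl⟩ := hg w
  exact LinearMap.congr_fun h w

theorem homDim_congr [FiniteDimensional k W] [FiniteDimensional k W'] [FiniteDimensional k N]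
    (e : W ≃ₗ[K] W') : homDim k K W N = homDim k K W' N :=
  le_antisymm (homDim_le_of_surjective k K e.symm.toLinearMap e.symm.surjective)
    (homDim_le_of_surjective k K e.toLinearMap e.surjective)

/-- Left exactness of `Hom`: a map that vanishes on `S` factors through `W ⧸ S`. -/
theorem homDim_le_add [FiniteDimensional k W] [FiniteDimensional k N] (S : Submodule K W) :
    homDim k K W N ≤ homDim k K S N + homDim k K (W ⧸ S) N := by
  have := finiteDimensional_submodule k K S
  have h := (precomp k K N S.subtype).finrank_range_add_finrank_ker
  have h₁ : finrank k (LinearMap.range (precomp k K N S.subtype)) ≤ homDim k K S N :=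
    Submodule.finrank_le _
  have h₂ : LinearMap.ker (precomp k K N S.subtype) ≤
      LinearMap.range (precomp k K N S.mkQ) := by
    intro f hf
    refine ⟨S.liftQ f ?_, by ext w; rfl⟩
    intro w hw
    exact LinearMap.congr_fun hf ⟨w, hw⟩
  have h₃ := (Submodule.finrank_mono h₂).trans
    (LinearMap.finrank_range_le (precomp k K N S.mkQ))
  unfold homDim at *
  omega

theorem homDim_pi [FiniteDimensional k W] [FiniteDimensional k N] {ι : Type*} [Fintype ι] [DecidableEq ι] :
    homDim k K (ι → W) N = Fintype.card ι * homDim k K W N := by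
  have e : (ι → W →ₗ[K] N) ≃ₗ[k] ((ι → W) →ₗ[K] N) :=
    LinearMap.lsum K (fun _ => W) k
  rw [homDim, ← e.finrank_eq, finrank_pi_fintype]
  simp [homDim]

theorem homDim_le_mul [FiniteDimensional k W] [FiniteDimensional k N] : homDim k K W N ≤ finrank k W * finrank k N := by
  rw [← finrank_linearMap k k W N]
  exact LinearMap.finrank_le_finrank_of_injective (f := LinearMap.restrictScalarsₗ k K W N k)
    (LinearMap.restrictScalars_injective k)

theorem homDim_self : homDim k K K N = finrank k N :=
  (LinearMap.ringLmapEquivSelf K k N).finrank_eq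

theorem finrank_quotient_add [FiniteDimensional k W] (S : Submodule K W) :
    finrank k (W ⧸ S) + finrank k S = finrank k W :=
  Submodule.finrank_quotient_add_finrank (S.restrictScalars k)

end HomDim

/-! ### Modules of maximal ratio `dim Hom_K(W, N) / dim W` -/

section MaxRatio

universe u

variable (k : Type*) (K : Type u) (N : Type*) [Field k] [Ring K] [Algebra k K]
  [AddCommGroup N] [Module k N] [Module K N] [IsScalarTower k K N]

/-- `dim Hom_K(W, N) / dim W ≤ m / d` for all finite dimensional `K`-modules `W`. -/
def RatioBound (d m : ℕ) : Prop :=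
  ∀ (W : Type u) [AddCommGroup W] [Module k W] [Module K W] [IsScalarTower k K W]
    [FiniteDimensional k W], homDim k K W N * d ≤ m * finrank k W

/-- A larger module has a nonzero cyclic submodule, of dimension at most `dim K`; the bounds for it
and for the quotient add up by subadditivity. -/
theorem ratioBound_of_le [FiniteDimensional k K] [FiniteDimensional k N] {d m : ℕ}
    (h : ∀ (W : Type u) [AddCommGroup W] [Module k W] [Module K W] [IsScalarTower k K W]
      [FiniteDimensional k W], finrank k W ≤ finrank k K → homDim k K W N * d ≤ m * finrank k W) :
    RatioBound k K N d m := by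
  intro W _ _ _ _ _
  induction hn : finrank k W using Nat.strong_induction_on generalizing W with
  | _ n ih =>
  by_cases hle : finrank k W ≤ finrank k K
  · exact hn ▸ h W hle
  · have : Nontrivial W := nontrivial_of_finrank_pos (R := k) (by omega)
    obtain ⟨w, hw⟩ := exists_ne (0 : W)
    let g : K →ₗ[K] W := LinearMap.toSpanSingleton K W w
    have := finiteDimensional_submodule k K (LinearMap.range g)
    have hS : finrank k (LinearMap.range g) ≤ finrank k K :=
      LinearMap.finrank_range_le (g.restrictScalars k)
    have hS' : 0 < finrank k (LinearMap.range g) := by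
      have : Nontrivial (LinearMap.range g) := by
        refine ⟨⟨⟨w, ⟨1, by simp [g]⟩⟩, 0, fun h => hw (congrArg Subtype.val h)⟩⟩
      exact finrank_pos
    have hadd := finrank_quotient_add k K (LinearMap.range g)
    have h₁ := h (LinearMap.range g) hS
    have h₂ := ih (finrank k (W ⧸ LinearMap.range g)) (by omega) (W ⧸ LinearMap.range g) rfl
    calc homDim k K W N * d
        ≤ (homDim k K (LinearMap.range g) N + homDim k K (W ⧸ LinearMap.range g) N) * d :=
          Nat.mul_le_mul_right _ (homDim_le_add k K _)
      _ ≤ m * (finrank k (W ⧸ LinearMap.range g) + finrank k (LinearMap.range g)) := by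
          rw [add_mul, mul_add, add_comm]; exact add_le_add h₂ h₁
      _ = m * n := by rw [hadd, hn]

theorem exists_ratioBound [Nontrivial K] [FiniteDimensional k K] [FiniteDimensional k N] :
    ∃ (W : Type u) (_ : AddCommGroup W) (_ : Module k W) (_ : Module K W)
      (_ : IsScalarTower k K W) (_ : FiniteDimensional k W),
      0 < finrank k W ∧ RatioBound k K N (finrank k W) (homDim k K W N) := by
  let s : Set (ℕ × ℕ) := {x | ∃ (W : Type u) (_ : AddCommGroup W) (_ : Module k W) (_ : Module K W)
      (_ : IsScalarTower k K W) (_ : FiniteDimensional k W),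
      0 < finrank k W ∧ finrank k W ≤ finrank k K ∧ x = (finrank k W, homDim k K W N)}
  have hfin : s.Finite := by
    refine ((Set.finite_Iic (finrank k K)).prod
      (Set.finite_Iic (finrank k K * finrank k N))).subset ?_
    rintro _ ⟨W, _, _, _, _, _, -, h, rfl⟩
    exact ⟨h, (homDim_le_mul k K).trans (Nat.mul_le_mul_right _ h)⟩
  have hne : s.Nonempty :=
    ⟨_, K, inferInstance, inferInstance, inferInstance, inferInstance, inferInstance,
      finrank_pos, le_rfl, rfl⟩
  obtain ⟨_, ⟨W, i₁, i₂, i₃, i₄, i₅, hpos, -, rfl⟩, hmax⟩ :=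
    Set.exists_max_image s (fun x => (x.2 : ℚ) / x.1) hfin hne
  refine ⟨W, i₁, i₂, i₃, i₄, i₅, hpos, ratioBound_of_le k K N ?_⟩
  intro V _ _ _ _ _ hV
  rcases Nat.eq_zero_or_pos (finrank k V) with h0 | h0
  · have := homDim_le_mul k K (W := V) (N := N)
    rw [h0, zero_mul] at this
    rw [Nat.le_zero.mp this, zero_mul]
    exact Nat.zero_le _
  · have := hmax _ ⟨V, inferInstance, inferInstance, inferInstance, inferInstance, inferInstance,
      h0, hV, rfl⟩
    rw [div_le_div_iff₀ (by exact_mod_cast h0) (by exact_mod_cast hpos)] at this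
    exact_mod_cast this

variable {k K N} {W : Type u} [AddCommGroup W] [Module k W] [Module K W] [IsScalarTower k K W]
  [FiniteDimensional k W] [FiniteDimensional k N] {d m : ℕ}

/-- `hW` says that `W` attains the bound. If `S` fell short, subadditivity would force `W ⧸ S` to
exceed it. -/
theorem RatioBound.submodule (h : RatioBound k K N d m)
    (hW : m * finrank k W ≤ homDim k K W N * d) (S : Submodule K W) :
    m * finrank k S ≤ homDim k K S N * d := by
  have h₁ := h (W ⧸ S)
  have h₂ := Nat.mul_le_mul_right d (homDim_le_add k K (N := N) S)
  rw [← finrank_quotient_add k K S, mul_add] at hW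
  rw [add_mul] at h₂
  omega

theorem RatioBound.quotient (h : RatioBound k K N d m)
    (hW : m * finrank k W ≤ homDim k K W N * d) (S : Submodule K W) :
    m * finrank k (W ⧸ S) ≤ homDim k K (W ⧸ S) N * d := by
  have := finiteDimensional_submodule k K S
  have h₁ := h S
  have h₂ := Nat.mul_le_mul_right d (homDim_le_add k K (N := N) S)
  rw [← finrank_quotient_add k K S, mul_add] at hW
  rw [add_mul] at h₂
  omega

end MaxRatio

/-! ### Elements annihilated by a proper left ideal -/

namespace ModuleAlg

universe u v

variable {k : Type*} {H : Type v} {K : Type (max u v)} [Field k] [Ring H] [HopfAlgebra k H]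
  [Ring K] [Algebra k K]
  {N : Type*} [AddCommGroup N] [Module k N] [Module K N] [IsScalarTower k K N]

/-- The map `n ⊗ p ↦ ∑ σ(p₁) n ⊗ p₂`. -/
noncomputable def twistMap (σ : H →ₗ[k] Module.End k N) : N ⊗[k] H →ₗ[k] N ⊗[k] H :=
  (TensorProduct.lift σ.flip).rTensor H ∘ₗ (TensorProduct.assoc k N H H).symm.toLinearMap ∘ₗ
    (comul (R := k) (A := H)).lTensor N

theorem twistMap_tmul (σ : H →ₗ[k] Module.End k N) (n : N) (p : H) {ι : Type*} (r : Repr k p ι) :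
    twistMap σ (n ⊗ₜ p) = ∑ i ∈ r.index, σ (r.left i) n ⊗ₜ[k] r.right i := by
  simp [twistMap, ← r.eq, TensorProduct.tmul_sum]

variable (D : ModuleAlg k H K)

/-- This is the `K`-linearity of `φ ↦ ∑ σ(p₁) g(φ(p₂))`, the source of maps out of the twisted
module. -/
theorem sum_twist_smul {W : Type*} [AddCommGroup W] [Module k W] [Module K W]
    [IsScalarTower k K W] {σ : H →ₗ[k] Module.End k N}
    (hσ : ∀ (u : K) (p : H) (n : N), u • σ p n =
      ∑ i ∈ (ℛ k p).index, σ ((ℛ k p).left i) (D.act ((ℛ k p).right i) u • n))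
    (g : W →ₗ[K] N) (u : K) (φ : D.Twist W) (p : H) :
    ∑ i ∈ (ℛ k p).index, σ ((ℛ k p).left i) (g ((u • φ) ((ℛ k p).right i))) =
      u • ∑ i ∈ (ℛ k p).index, σ ((ℛ k p).left i) (g (φ ((ℛ k p).right i))) := by
  have hg : ∀ (a : k) (w : W), g (a • w) = a • g w := fun a w =>
    (g.restrictScalars k).map_smul a w
  simp only [Twist.smul_apply D u φ (ℛ k _), map_sum, map_smul, Finset.smul_sum, hσ u]
  refine (sum_coassoc (ℛ k p) (fun x y z => σ x (D.act y u • g (φ z))) ?_ ?_ ?_).symm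
  · intro y z
    constructor <;> intros <;> simp
  · intro x z
    constructor <;> intros <;> simp [add_smul]
  · intro x y
    exact ⟨fun _ _ => by simp, fun a z => by rw [map_smul φ, hg, smul_comm, map_smul]⟩

/-- Each basis vector `p` of `H` and each `g : W → N` give the map `φ ↦ ∑ σ(p₁) g(φ(p₂))`. Testing
on the functions `l(-) w` reduces independence of these maps to injectivity of `twistMap σ`. -/
theorem mul_homDim_le_homDim_twist {W : Type*} [AddCommGroup W] [Module k W] [Module K W]
    [IsScalarTower k K W] [FiniteDimensional k W] [FiniteDimensional k H] [FiniteDimensional k N]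
    {σ : H →ₗ[k] Module.End k N}
    (hσ : ∀ (u : K) (p : H) (n : N), u • σ p n =
      ∑ i ∈ (ℛ k p).index, σ ((ℛ k p).left i) (D.act ((ℛ k p).right i) u • n))
    (hinj : Function.Injective (twistMap σ)) :
    finrank k H * homDim k K W N ≤ homDim k K (D.Twist W) N := by
  let b := Module.finBasis k H
  let Ψ : (Fin (finrank k H) → W →ₗ[K] N) →ₗ[k] (D.Twist W →ₗ[K] N) :=
    { toFun := fun g =>
        { toFun := fun φ => ∑ i, ∑ j ∈ (ℛ k (b i)).index,
            σ ((ℛ k (b i)).left j) (g i (φ ((ℛ k (b i)).right j)))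
          map_add' := fun φ χ => by simp [Finset.sum_add_distrib]
          map_smul' := fun u φ => by
            simp only [sum_twist_smul D hσ, RingHom.id_apply]
            rw [Finset.smul_sum] }
      map_add' := fun g g' => by
        ext φ
        simp [Finset.sum_add_distrib]
      map_smul' := fun a g => by
        ext φ
        simp [Finset.smul_sum] }
  have hΨ : Function.Injective Ψ := by
    rw [injective_iff_map_eq_zero]
    intro g hg
    have key : ∀ w : W, ∑ i, g i w ⊗ₜ[k] b i = 0 := by
      intro w
      refine hinj ?_
      rw [map_zero, map_sum]
      simp only [twistMap_tmul σ _ _ (ℛ k _)]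
      have hl : ∀ l : H →ₗ[k] k, l.lTensor N (∑ i, ∑ j ∈ (ℛ k (b i)).index,
          σ ((ℛ k (b i)).left j) (g i w) ⊗ₜ[k] (ℛ k (b i)).right j) = 0 := by
        intro l
        have h := LinearMap.congr_fun hg (Twist.single D l w)
        refine (TensorProduct.rid k N).injective ?_
        rw [map_zero]
        refine Eq.trans ?_ h
        have hg' : ∀ (i) (a : k) (w : W), g i (a • w) = a • g i w := fun i a w =>
          ((g i).restrictScalars k).map_smul a w
        simp [Ψ, hg']
      generalize (∑ i, ∑ j ∈ (ℛ k (b i)).index,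
          σ ((ℛ k (b i)).left j) (g i w) ⊗ₜ[k] (ℛ k (b i)).right j) = z at hl
      obtain ⟨c, rfl⟩ := TensorProduct.eq_repr_basis_right b z
      have hc : ∀ i, c i = 0 := by
        intro i
        have h := congrArg (TensorProduct.rid k N) (hl (b.coord i))
        simpa [Finsupp.sum_fintype, Finsupp.single_apply] using h
      simp [Finsupp.sum, hc]
    funext i
    ext w
    have h := congrArg (fun x => TensorProduct.rid k N ((b.coord i).lTensor N x)) (key w)
    simpa [Finsupp.single_apply] using h
  have h := LinearMap.finrank_le_finrank_of_injective hΨ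
  rw [finrank_pi_fintype] at h
  simpa [homDim] using h

/-- The left ideal `P` is a two-sided ideal stable under the action of `H`. -/
structure IsStableIdeal (P : Ideal K) : Prop where
  mul_mem_right : ∀ u ∈ P, ∀ v : K, u * v ∈ P
  act_mem : ∀ (p : H), ∀ u ∈ P, D.act p u ∈ P

/-- Let `K` be an `H`-module algebra and `N` a `K`-module with an action of `H` twisting the one
of `K`. If no nonzero `H`-stable ideal annihilates a nonzero element of `N`, then every proper left
ideal annihilates a nonzero element of `N`. -/
theorem exists_ne_zero_forall_smul_eq_zero [FiniteDimensional k H] [FiniteDimensional k K]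
    [FiniteDimensional k N] [Nontrivial K] [Nontrivial N]
    {σ : H →ₗ[k] Module.End k N}
    (hσ : ∀ (u : K) (p : H) (n : N), u • σ p n =
      ∑ i ∈ (ℛ k p).index, σ ((ℛ k p).left i) (D.act ((ℛ k p).right i) u • n))
    (hinj : Function.Injective (twistMap σ))
    (hP : ∀ P : Ideal K, D.IsStableIdeal P → P ≠ ⊥ → ∀ n : N, (∀ u ∈ P, u • n = 0) → n = 0)
    (L : Ideal K) (hL : L ≠ ⊤) : ∃ n : N, n ≠ 0 ∧ ∀ u ∈ L, u • n = 0 := by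
  obtain ⟨W, _, _, _, _, _, hd, hW⟩ := exists_ratioBound k K N
  -- The maximal ratio is positive because `Hom_K(K, N) ≅ N ≠ 0`.
  have hm : 0 < homDim k K W N := by
    have h := hW K
    rw [homDim_self] at h
    have : 0 < finrank k N * finrank k W := Nat.mul_pos finrank_pos hd
    exact Nat.pos_of_mul_pos_right (this.trans_le h)
  have hX := D.mul_homDim_le_homDim_twist (W := W) hσ hinj
  have : Nontrivial H := Bialgebra.nontrivial (R := k)
  have hann : Module.annihilator K (D.Twist W) = ⊥ := by
    by_contra hne
    have hst : D.IsStableIdeal (Module.annihilator K (D.Twist W)) := by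
      refine ⟨fun u hu v => ?_, fun p u hu => ?_⟩
      · rw [Module.mem_annihilator] at hu ⊢
        intro φ
        rw [mul_smul, hu]
      · rw [mem_annihilator_twist] at hu ⊢
        intro q w
        rw [← Module.End.mul_apply, ← map_mul]
        exact hu _ w
    have : Subsingleton (D.Twist W →ₗ[K] N) := by
      refine subsingleton_of_forall_eq 0 fun f => ?_
      ext φ
      refine hP _ hst hne _ fun u hu => ?_
      rw [← map_smul, Module.mem_annihilator.mp hu, map_zero]
    have h0 : homDim k K (D.Twist W) N = 0 := finrank_zero_of_subsingleton
    rw [h0] at hX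
    exact absurd hX (by have := Nat.mul_pos (finrank_pos (R := k) (M := H)) hm; omega)
  let b := Module.finBasis k (D.Twist W)
  let ι := Fin (finrank k (D.Twist W))
  let e : K →ₗ[K] (ι → D.Twist W) := LinearMap.pi fun i => LinearMap.toSpanSingleton K _ (b i)
  have he : Function.Injective e := by
    rw [injective_iff_map_eq_zero]
    intro u hu
    have : u ∈ Module.annihilator K (D.Twist W) := by
      rw [Module.mem_annihilator]
      have h0 : (Algebra.lsmul k k (D.Twist W) u : D.Twist W →ₗ[k] D.Twist W) = 0 :=
        b.ext fun i => congrFun hu i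
      exact fun φ => LinearMap.congr_fun h0 φ
    rwa [hann] at this
  have hY : homDim k K W N * finrank k (ι → D.Twist W) ≤
      homDim k K (ι → D.Twist W) N * finrank k W := by
    have hX' : finrank k (ι → D.Twist W) =
        Fintype.card ι * (finrank k H * finrank k W) := by
      simp [finrank_pi_fintype, ← finrank_twist D]
    rw [homDim_pi, hX']
    calc homDim k K W N * (Fintype.card ι * (finrank k H * finrank k W))
        = Fintype.card ι * (finrank k H * homDim k K W N) * finrank k W := by ring
      _ ≤ _ := Nat.mul_le_mul_right _ (Nat.mul_le_mul_left _ hX)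
  have := finiteDimensional_submodule k K (LinearMap.range e)
  have hR := hW.submodule hY (LinearMap.range e)
  -- `K` attains the maximal ratio, being a submodule of a power of the extremal module `D.Twist W`.
  have hK : homDim k K W N * finrank k K ≤ homDim k K K N * finrank k W := by
    rw [homDim_congr k K (LinearEquiv.ofInjective e he),
      ((LinearEquiv.ofInjective e he).restrictScalars k).finrank_eq]
    exact hR
  have hQ := hW.quotient hK L
  have hQ' : 0 < finrank k (K ⧸ L) := by
    have := Submodule.Quotient.nontrivial_iff.mpr hL
    exact finrank_pos
  have hpos : 0 < homDim k K (K ⧸ L) N :=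
    Nat.pos_of_mul_pos_right ((Nat.mul_pos hm hQ').trans_le hQ)
  have := nontrivial_of_finrank_pos hpos
  obtain ⟨f, hf⟩ := exists_ne (0 : K ⧸ L →ₗ[K] N)
  refine ⟨f (L.mkQ 1), fun h0 => hf ?_, fun u hu => ?_⟩
  · ext
    exact h0
  · rw [← map_smul, ← map_smul, smul_eq_mul, mul_one]
    simp [(Submodule.Quotient.mk_eq_zero L).mpr hu]

end ModuleAlg

/-! ### Contracting a coproduct with a functional -/

section Contraction

variable {k H : Type*} [Field k] [AddCommGroup H] [Module k H] [Coalgebra k H]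

/-- The map `c ↦ ∑ l(c₂) c₁`. -/
noncomputable def contractRight (l : H →ₗ[k] k) : H →ₗ[k] H :=
  (TensorProduct.rid k H).toLinearMap ∘ₗ l.lTensor H ∘ₗ comul

/-- The map `c ↦ ∑ l(c₁) c₂`. -/
noncomputable def contractLeft (l : H →ₗ[k] k) : H →ₗ[k] H :=
  (TensorProduct.lid k H).toLinearMap ∘ₗ l.rTensor H ∘ₗ comul

theorem contractRight_apply (l : H →ₗ[k] k) {c : H} {ι : Type*} (r : Repr k c ι) :
    contractRight l c = ∑ i ∈ r.index, l (r.right i) • r.left i := by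
  simp [contractRight, ← r.eq]

theorem contractLeft_apply (l : H →ₗ[k] k) {c : H} {ι : Type*} (r : Repr k c ι) :
    contractLeft l c = ∑ i ∈ r.index, l (r.left i) • r.right i := by
  simp [contractLeft, ← r.eq]

theorem apply_contractRight (p l : H →ₗ[k] k) (c : H) :
    p (contractRight l c) = (toConv p * toConv l) c := by
  rw [contractRight_apply l (ℛ k c), (ℛ k c).convMul_apply]
  simp [mul_comm]

theorem apply_contractLeft (p l : H →ₗ[k] k) (c : H) :
    p (contractLeft l c) = l (contractRight p c) := by
  rw [contractRight_apply p (ℛ k c), contractLeft_apply l (ℛ k c)]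
  simp [mul_comm]

theorem counit_contractRight (l : H →ₗ[k] k) (c : H) :
    counit (R := k) (contractRight l c) = l c := by
  rw [contractRight_apply l (ℛ k c), ← sum_counit_smul_map (ℛ k c) l]
  simp [mul_comm]

theorem counit_contractLeft (l : H →ₗ[k] k) (c : H) :
    counit (R := k) (contractLeft l c) = l c := by
  rw [contractLeft_apply l (ℛ k c), ← sum_smul_counit_map (ℛ k c) l]
  simp [mul_comm]

theorem contractRight_contractLeft (p l : H →ₗ[k] k) (c : H) :
    contractRight p (contractLeft l c) = contractLeft l (contractRight p c) := by
  rw [contractLeft_apply l (ℛ k c), contractRight_apply p (ℛ k c), map_sum, map_sum]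
  simp only [map_smul]
  simp only [contractLeft_apply l (ℛ k _), contractRight_apply p (ℛ k _), Finset.smul_sum]
  refine (sum_coassoc (ℛ k c) (fun x y z => l x • p z • y) ?_ ?_ ?_).symm.trans ?_
  · intro y z
    constructor <;> intros <;> simp [add_smul, mul_smul]
  · intro x z
    exact ⟨fun _ _ => by simp, fun a y => by rw [smul_comm (p z), smul_comm (l x)]⟩
  · intro x y
    exact ⟨fun _ _ => by simp [add_smul], fun a z => by
      simp only [map_smul, smul_eq_mul, mul_smul]; rw [smul_comm]⟩
  · exact Finset.sum_congr rfl fun i _ => Finset.sum_congr rfl fun j _ => smul_comm _ _ _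

theorem contractRight_mul (u v : WithConv (H →ₗ[k] k)) (c : H) :
    contractRight (u * v).ofConv c = contractRight u.ofConv (contractRight v.ofConv c) := by
  rw [contractRight_apply _ (ℛ k c), contractRight_apply v.ofConv (ℛ k c), map_sum]
  simp only [map_smul]
  simp only [contractRight_apply u.ofConv (ℛ k _), (ℛ k _).convMul_apply, Finset.smul_sum,
    Finset.sum_smul]
  refine (sum_coassoc (ℛ k c) (fun x y z => (u y * v z) • x) ?_ ?_ ?_).symm.trans ?_
  · intro y z
    exact ⟨fun _ _ => by simp, fun a x => smul_comm _ _ _⟩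
  · intro x z
    constructor <;> intros <;> simp [add_smul, add_mul, mul_smul]
  · intro x y
    constructor <;> intros <;> simp [add_smul, mul_add, mul_smul, mul_left_comm]
  · exact Finset.sum_congr rfl fun i _ => Finset.sum_congr rfl fun j _ => by
      rw [mul_comm, mul_smul]

theorem contractRight_counit (c : H) : contractRight (counit (R := k)) c = c := by
  rw [contractRight_apply _ (ℛ k c)]
  exact sum_smul_counit_map (ℛ k c) .id

variable {ι : Type*} [Fintype ι]

/-- The expansion of `Δ(c)` whose right factors form a given basis. -/
noncomputable def reprBasisRight (b : Basis ι k H) (c : H) : Repr k c ι where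
  index := Finset.univ
  left i := contractRight (b.coord i) c
  right i := b i
  eq := by
    classical
    simp only [contractRight, LinearMap.comp_apply]
    generalize comul (R := k) c = z
    induction z with
    | zero => simp
    | add x y hx hy => simp_all [TensorProduct.add_tmul, Finset.sum_add_distrib]
    | tmul x y =>
      conv_rhs => rw [← b.sum_repr y]
      simp only [TensorProduct.tmul_sum]
      simp [TensorProduct.smul_tmul]

/-- The expansion of `Δ(c)` whose left factors form a given basis. -/
noncomputable def reprBasisLeft (b : Basis ι k H) (c : H) : Repr k c ι where
  index := Finset.univ
  left i := b i
  right i := contractLeft (b.coord i) c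
  eq := by
    classical
    simp only [contractLeft, LinearMap.comp_apply]
    generalize comul (R := k) c = z
    induction z with
    | zero => simp
    | add x y hx hy => simp_all [TensorProduct.tmul_add, Finset.sum_add_distrib]
    | tmul x y =>
      conv_rhs => rw [← b.sum_repr x]
      simp only [TensorProduct.sum_tmul]
      simp [TensorProduct.smul_tmul']

end Contraction

/-! ### Twisting by the antipode -/

section TwistInjective

variable {k H N : Type*} [Field k] [Ring H] [HopfAlgebra k H] [AddCommGroup N] [Module k N]

/-- The condition `τ(p₂) σ(p₁) = ε(p)` makes `twistMap τ` a left inverse, by coassociativity. -/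
theorem twistMap_injective (σ τ : H →ₗ[k] Module.End k N)
    (h : ∀ p, ∑ i ∈ (ℛ k p).index, τ ((ℛ k p).right i) * σ ((ℛ k p).left i) =
      counit (R := k) p • 1) : Function.Injective (ModuleAlg.twistMap σ) := by
  refine Function.LeftInverse.injective (g := ModuleAlg.twistMap τ) ?_
  suffices hs : ModuleAlg.twistMap τ ∘ₗ ModuleAlg.twistMap σ = LinearMap.id from
    LinearMap.congr_fun hs
  ext n p
  simp only [TensorProduct.AlgebraTensorModule.curry_apply, TensorProduct.curry_apply,
    LinearMap.coe_restrictScalars, LinearMap.comp_apply, LinearMap.id_apply]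
  rw [ModuleAlg.twistMap_tmul σ n p (ℛ k p), map_sum]
  simp only [ModuleAlg.twistMap_tmul τ _ _ (ℛ k _)]
  refine (sum_coassoc (ℛ k p) (fun x y z => τ y (σ x n) ⊗ₜ[k] z) ?_ ?_ ?_).symm.trans ?_
  · intro y z
    constructor <;> intros <;> simp [TensorProduct.add_tmul, TensorProduct.smul_tmul']
  · intro x z
    constructor <;> intros <;> simp [TensorProduct.add_tmul, TensorProduct.smul_tmul']
  · intro x y
    constructor <;> intros <;> simp [TensorProduct.tmul_add]
  · refine Eq.trans ?_ (sum_counit_smul_map (ℛ k p) (TensorProduct.mk k N H n))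
    refine Finset.sum_congr rfl fun i _ => ?_
    have h' := LinearMap.congr_fun (h ((ℛ k p).left i)) n
    simp only [LinearMap.sum_apply, Module.End.mul_apply, LinearMap.smul_apply,
      Module.End.one_apply] at h'
    rw [← TensorProduct.sum_tmul, h', ← TensorProduct.smul_tmul']
    rfl

end TwistInjective

namespace ModuleAlg

variable {k H K : Type*} [Field k] [Ring H] [HopfAlgebra k H] [Ring K] [Algebra k K]
  (D : ModuleAlg k H K)

/-- The map `p ↦ (u ↦ S(p) u)`. -/
noncomputable def actAntipode : H →ₗ[k] Module.End k K := D.act.toLinearMap ∘ₗ antipode k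

@[simp] theorem actAntipode_apply (p : H) : D.actAntipode p = D.act (antipode k p) := rfl

/-- In the convolution algebra `Hom(H, End K)` the action `α` has inverse `αS`, and the module
algebra axiom reads `β * α = α * c`; multiplying by `αS` on both sides gives the claim. -/
theorem mul_actAntipode (u : K) (p : H) (v : K) : u • D.actAntipode p v =
    ∑ i ∈ (ℛ k p).index, D.actAntipode ((ℛ k p).left i) (D.act ((ℛ k p).right i) u • v) := by
  let α : WithConv (H →ₗ[k] Module.End k K) := toConv D.act.toLinearMap
  let αS : WithConv (H →ₗ[k] Module.End k K) := toConv D.actAntipode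
  let β : WithConv (H →ₗ[k] Module.End k K) := toConv (LinearMap.mul k K ∘ₗ D.act.toLinearMap.flip u)
  let c : WithConv (H →ₗ[k] Module.End k K) := toConv (counit.smulRight (LinearMap.mul k K u))
  have h₁ : α * αS = 1 := by
    have h := congrArg (fun f : WithConv (H →ₗ[k] H) => D.act.toLinearMap ∘ₗ f.ofConv)
      (LinearMap.id_mul_antipode (R := k) (C := H))
    simp only [LinearMap.algHom_comp_convMul_distrib] at h
    apply WithConv.ext
    refine Eq.trans ?_ (h.trans ?_)
    · rfl
    · ext p
      simp
  have h₂ : αS * α = 1 := by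
    have h := congrArg (fun f : WithConv (H →ₗ[k] H) => D.act.toLinearMap ∘ₗ f.ofConv)
      (LinearMap.antipode_mul_id (R := k) (C := H))
    simp only [LinearMap.algHom_comp_convMul_distrib] at h
    apply WithConv.ext
    refine Eq.trans ?_ (h.trans ?_)
    · rfl
    · ext p
      simp
  have h₃ : β * α = α * c := by
    ext p v
    change (β * α) p v = (α * c) p v
    rw [(ℛ k p).convMul_apply, (ℛ k p).convMul_apply]
    simp only [LinearMap.sum_apply, Module.End.mul_apply]
    refine (D.act_mul p u v).symm.trans ?_
    refine (sum_smul_counit_map (ℛ k p) (D.act.toLinearMap.flip (u * v))).symm.trans ?_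
    simp [α, c]
  have h₄ : αS * β = c * αS := by
    calc αS * β = αS * (β * α) * αS := by rw [mul_assoc, mul_assoc, h₁, mul_one]
      _ = (αS * α) * c * αS := by rw [h₃]; simp only [mul_assoc]
      _ = c * αS := by rw [h₂, one_mul]
  have h₅ := congrArg (fun f : WithConv (H →ₗ[k] Module.End k K) => f p v) h₄
  simp only [(ℛ k p).convMul_apply, LinearMap.sum_apply, Module.End.mul_apply] at h₅
  refine Eq.trans ?_ h₅.symm
  refine (sum_counit_smul_map (ℛ k p)
    (LinearMap.mul k K u ∘ₗ D.actAntipode.flip v)).symm.trans ?_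
  simp [αS, c]

theorem twistMap_actAntipode_injective : Function.Injective (twistMap D.actAntipode) := by
  refine twistMap_injective _ (D.actAntipode ∘ₗ antipode k) fun p => ?_
  simp only [LinearMap.comp_apply, actAntipode_apply, ← map_mul, ← antipode_mul_antidistrib,
    ← map_sum]
  rw [sum_mul_antipode_eq_smul]
  simp

end ModuleAlg

/-! ### The dual algebra `Q*` and its integrals -/

namespace GenQuot

universe u v

variable {k : Type u} {H : Type v} [Field k] [Ring H] [HopfAlgebra k H] (Q : GenQuot k H)

/-- The algebra `Q*`, realised as the subalgebra of `H*` of all functionals vanishing on the kernel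
of `H → Q`. -/
def dualAlg : Subalgebra k (WithConv (H →ₗ[k] k)) where
  carrier := {u | ∀ x ∈ Q.ker, u x = 0}
  add_mem' := by
    intro u v hu hv x hx
    simp [hu x hx, hv x hx]
  mul_mem' := by
    intro u v hu hv x hx
    have hu' : Q.ker.liftQ u.ofConv hu ∘ₗ Q.ker.mkQ = u.ofConv := Submodule.liftQ_mkQ _ _ _
    have hv' : Q.ker.liftQ v.ofConv hv ∘ₗ Q.ker.mkQ = v.ofConv := Submodule.liftQ_mkQ _ _ _
    rw [LinearMap.convMul_apply, ← hu', ← hv', TensorProduct.map_comp, LinearMap.comp_apply,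
      Q.isCoideal.map_mkQ_comul_eq_zero hx, map_zero, map_zero]
  algebraMap_mem' := by
    intro r x hx
    simp [Q.isCoideal.counit_eq_zero hx]

variable {Q}

theorem dualAlg_ext {u v : Q.dualAlg} (h : ∀ x, u.1 x = v.1 x) : u = v :=
  Subtype.ext (WithConv.ext (LinearMap.ext h))

theorem dualAlg_mul_apply (u v : Q.dualAlg) {x : H} {ι : Type*} (r : Repr k x ι) :
    (u * v).1 x = ∑ i ∈ r.index, u.1 (r.left i) * v.1 (r.right i) :=
  r.convMul_apply u.1 v.1

theorem dualAlg_sum_apply {ι : Type*} (s : Finset ι) (u : ι → Q.dualAlg) (x : H) :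
    (∑ i ∈ s, u i).1 x = ∑ i ∈ s, (u i).1 x := by
  simp

variable (Q)

instance [FiniteDimensional k H] : FiniteDimensional k Q.dualAlg :=
  have : FiniteDimensional k (WithConv (H →ₗ[k] k)) :=
    (WithConv.linearEquiv k (H →ₗ[k] k)).symm.finiteDimensional
  inferInstanceAs (FiniteDimensional k (Subalgebra.toSubmodule Q.dualAlg))

instance : Nontrivial Q.dualAlg := by
  refine ⟨⟨1, 0, fun h => one_ne_zero (α := k) ?_⟩⟩
  have h' := congrArg (fun u : Q.dualAlg => u.1 1) h
  simp at h'

/-- The endomorphism `u ↦ (x ↦ u(x p))` of `Q*`. -/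
def dualTranslate (p : H) : Module.End k Q.dualAlg where
  toFun u := ⟨toConv (u.1.ofConv ∘ₗ LinearMap.mulRight k p), fun _ hx => u.2 _ (Q.mul_mem hx p)⟩
  map_add' _ _ := rfl
  map_smul' _ _ := rfl

/-- The action of `H` on `Q*` given by `(p u)(x) = u(x p)`. -/
noncomputable def dualAct : H →ₐ[k] Module.End k Q.dualAlg :=
  AlgHom.ofLinearMap
    { toFun := Q.dualTranslate
      map_add' := fun p q => LinearMap.ext fun u => dualAlg_ext fun x => by
        change u.1 (x * (p + q)) = u.1 (x * p) + u.1 (x * q)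
        rw [mul_add, map_add]
      map_smul' := fun a p => LinearMap.ext fun u => dualAlg_ext fun x => by
        change u.1 (x * (a • p)) = a • u.1 (x * p)
        rw [mul_smul_comm, map_smul] }
    (LinearMap.ext fun u => dualAlg_ext fun x => by
      change u.1 (x * 1) = u.1 x
      rw [mul_one])
    (fun p q => LinearMap.ext fun u => dualAlg_ext fun x => by
      change u.1 (x * (p * q)) = u.1 (x * p * q)
      rw [mul_assoc])

theorem dualAct_apply (p : H) (u : Q.dualAlg) (x : H) :
    (Q.dualAct p u).1 x = u.1 (x * p) := rfl

/-- `Q*` as an `H`-module algebra. -/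
noncomputable def dualModuleAlg : ModuleAlg k H Q.dualAlg where
  act := Q.dualAct
  act_mul p u v := by
    refine dualAlg_ext fun x => ?_
    rw [dualAct_apply, dualAlg_mul_apply u v ((ℛ k x).mul (ℛ k p)), dualAlg_sum_apply]
    simp only [dualAlg_mul_apply _ _ (ℛ k x), dualAct_apply]
    rw [Finset.sum_comm]
    exact Finset.sum_product _ _ _
  act_one p := by
    refine dualAlg_ext fun x => ?_
    change counit (R := k) (x * p) = counit (R := k) p * counit (R := k) x
    rw [Bialgebra.counit_mul, mul_comm]

@[simp] theorem dualModuleAlg_act_apply (p : H) (u : Q.dualAlg) (x : H) :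
    (Q.dualModuleAlg.act p u).1 x = u.1 (x * p) := rfl

/-- `t` is a left integral in the augmented algebra `Q*`. -/
def IsIntegral (t : Q.dualAlg) : Prop := ∀ u : Q.dualAlg, u * t = u.1 1 • t

variable {Q}

theorem IsIntegral.mul_act {t : Q.dualAlg} (ht : Q.IsIntegral t) (u : Q.dualAlg) (p : H) :
    u * Q.dualModuleAlg.actAntipode p t =
      ∑ i ∈ (ℛ k p).index, u.1 ((ℛ k p).right i) •
        Q.dualModuleAlg.actAntipode ((ℛ k p).left i) t := by
  rw [← smul_eq_mul, ModuleAlg.mul_actAntipode]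
  refine Finset.sum_congr rfl fun i _ => ?_
  rw [smul_eq_mul, ht, map_smul, dualModuleAlg_act_apply, one_mul]

variable (Q)

/-- An integral is an element killed by the augmentation ideal `{u | u(1) = 0}`, a proper left
ideal. The hypothesis on stable ideals is kept, since it is verified differently for `H` and for
general `Q`. -/
theorem exists_isIntegral [FiniteDimensional k H]
    (hP : ∀ P : Ideal Q.dualAlg, Q.dualModuleAlg.IsStableIdeal P → P ≠ ⊥ →
      ∀ n : Q.dualAlg, (∀ u ∈ P, u * n = 0) → n = 0) :
    ∃ t : Q.dualAlg, t ≠ 0 ∧ Q.IsIntegral t := by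
  let L : Ideal Q.dualAlg :=
    { carrier := {u | u.1 1 = 0}
      add_mem' := by
        intro u v hu hv
        change u.1 1 + v.1 1 = 0
        rw [show u.1 1 = 0 from hu, show v.1 1 = 0 from hv, add_zero]
      zero_mem' := rfl
      smul_mem' := by
        intro u v hv
        change (u.1 * v.1) 1 = 0
        rw [LinearMap.convMul_apply, Bialgebra.comul_one, Algebra.TensorProduct.one_def]
        simp [show v.1 1 = 0 from hv] }
  have hL : L ≠ ⊤ := by
    intro h
    have h1 : (1 : Q.dualAlg) ∈ L := h ▸ Submodule.mem_top
    have h2 : counit (R := k) (1 : H) = 0 := h1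
    simp at h2
  obtain ⟨t, ht, hLt⟩ := ModuleAlg.exists_ne_zero_forall_smul_eq_zero.{u, v} Q.dualModuleAlg
    (N := Q.dualAlg) (Q.dualModuleAlg.mul_actAntipode)
    (Q.dualModuleAlg.twistMap_actAntipode_injective) hP L hL
  refine ⟨t, ht, fun u => ?_⟩
  have hu : u - u.1 1 • 1 ∈ L := by
    change u.1 1 - u.1 1 • counit (R := k) (1 : H) = 0
    simp
  have h := hLt _ hu
  have h' : u * t - u.1 1 • 1 * t = 0 := (sub_mul u _ t).symm.trans h
  rw [smul_mul_assoc, one_mul] at h'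
  exact sub_eq_zero.mp h'

end GenQuot

/-! ### Bijectivity of the antipode -/

section Antipode

variable (k H : Type*) [Field k] [Ring H] [HopfAlgebra k H]

/-- The quotient `H / 0`. -/
def selfQuot : GenQuot k H where
  ker := ⊥
  isCoideal := ⟨by simp +contextual, by simp +contextual⟩
  mul_mem := by simp +contextual

variable {k H}

/-- A functional on `H` as an element of the dual algebra of `H / 0`. -/
def selfDual (l : H →ₗ[k] k) : (selfQuot k H).dualAlg :=
  ⟨toConv l, fun x hx => by rw [(Submodule.mem_bot k).mp hx]; exact map_zero _⟩

variable [FiniteDimensional k H]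

/-- For `u ∈ P`, `ε(c) u(g) = u(c₁ S(c₂) g)` is a sum of values at `c` of elements of `P`, as `P` is
stable and a right ideal; so `ε(c) = 0`. The same applies to every contraction `l(c₂) c₁`, whose
counit is `l(c)`. -/
theorem eq_zero_of_forall_mem_stable {P : Ideal (selfQuot k H).dualAlg}
    (hP : (selfQuot k H).dualModuleAlg.IsStableIdeal P) (hne : P ≠ ⊥) {c : H}
    (hc : ∀ u ∈ P, u.1 c = 0) : c = 0 := by
  have hcounit : ∀ c : H, (∀ u ∈ P, u.1 c = 0) → counit (R := k) c = 0 := by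
    intro c hc
    by_contra h0
    refine hne ((Submodule.eq_bot_iff _).mpr fun u hu => GenQuot.dualAlg_ext fun g => ?_)
    have h := congrArg (fun x => u.1 (x * g))
      (sum_mul_antipode_eq_smul (reprBasisRight (Module.finBasis k H) c))
    simp only [Finset.sum_mul, map_sum, smul_mul_assoc, one_mul, map_smul] at h
    rw [Finset.sum_eq_zero] at h
    · exact (smul_eq_zero.mp h.symm).resolve_left h0
    · intro i _
      have h1 := hP.mul_mem_right _ (hP.act_mem (antipode k (Module.finBasis k H i) * g) u hu)
        (selfDual ((Module.finBasis k H).coord i))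
      refine Eq.trans ?_ (hc _ h1)
      refine Eq.trans ?_ (apply_contractRight _ _ _)
      change u.1 (_ * _ * g) = u.1 (_ * _)
      rw [mul_assoc]
      rfl
  refine (Module.forall_dual_apply_eq_zero_iff k c).mp fun l => ?_
  rw [← counit_contractRight]
  refine hcounit _ fun u hu => ?_
  exact (apply_contractRight _ _ _).trans (hc _ (hP.mul_mem_right u hu (selfDual l)))

/-- If `S(h) = 0`, multiplying `S(h) t = 0` by all functionals `u` gives `∑ u(h₂) S(h₁) t = 0`.
Hence `∑ S(h₁) t ⊗ h₂ = 0`, and injectivity of the twist yields `t ⊗ h = 0`. -/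
theorem antipode_injective : Function.Injective (antipode k : H →ₗ[k] H) := by
  obtain ⟨t, ht, hint⟩ := (selfQuot k H).exists_isIntegral fun P hP hne n hn => by
    refine GenQuot.dualAlg_ext fun x => ?_
    rw [← counit_contractRight]
    have : contractRight n.1.ofConv x = 0 := by
      refine eq_zero_of_forall_mem_stable hP hne fun u hu => ?_
      have h := congrArg (fun v => v.1 x) (hn u hu)
      exact (apply_contractRight _ _ _).trans h
    rw [this, map_zero]
    rfl
  rw [injective_iff_map_eq_zero]
  intro h hh
  have hT : t ⊗ₜ[k] h = 0 := by
    refine (selfQuot k H).dualModuleAlg.twistMap_actAntipode_injective ?_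
    rw [map_zero, ModuleAlg.twistMap_tmul _ _ _ (reprBasisRight (Module.finBasis k H) h)]
    refine Finset.sum_eq_zero fun i _ => ?_
    have h1 := hint.mul_act (selfDual ((Module.finBasis k H).coord i)) h
    rw [ModuleAlg.actAntipode_apply, hh, map_zero, LinearMap.zero_apply, mul_zero] at h1
    have h2 : contractRight ((Module.finBasis k H).coord i) h =
        ∑ j ∈ (ℛ k h).index, (Module.finBasis k H).coord i ((ℛ k h).right j) • (ℛ k h).left j :=
      contractRight_apply _ _
    have h3 : (selfQuot k H).dualModuleAlg.actAntipode
        (contractRight ((Module.finBasis k H).coord i) h) t = 0 := by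
      rw [h2, map_sum, LinearMap.sum_apply]
      simp only [map_smul, LinearMap.smul_apply]
      exact h1.symm
    change _ ⊗ₜ[k] _ = (0 : _ ⊗[k] H)
    exact (congrArg (· ⊗ₜ[k] _) h3).trans (TensorProduct.zero_tmul _ _)
  obtain ⟨x, hx⟩ : ∃ x, t.1 x ≠ 0 := by
    by_contra! h0
    exact ht (GenQuot.dualAlg_ext h0)
  let l : (selfQuot k H).dualAlg →ₗ[k] k :=
    { toFun := fun u => u.1 x
      map_add' := fun _ _ => rfl
      map_smul' := fun _ _ => rfl }
  have h4 : l t • h = 0 := by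
    have h5 := congrArg (fun z => TensorProduct.lid k H (l.rTensor H z)) hT
    simpa using h5
  exact (smul_eq_zero.mp h4).resolve_left hx

theorem antipode_surjective : Function.Surjective (antipode k : H →ₗ[k] H) :=
  LinearMap.injective_iff_surjective.mp antipode_injective

variable (k H) in
/-- The antipode of a finite dimensional Hopf algebra, as a linear equivalence. -/
noncomputable def antipodeEquiv : H ≃ₗ[k] H :=
  LinearEquiv.ofBijective (antipode k) ⟨antipode_injective, antipode_surjective⟩

theorem sum_mul_antipodeEquiv_symm {ι : Type*} {c : H} (r : Repr k c ι) :
    ∑ i ∈ r.index, r.right i * (antipodeEquiv k H).symm (r.left i) = counit (R := k) c • 1 := by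
  have hS : ∀ x : H, antipode k ((antipodeEquiv k H).symm x) = x := (antipodeEquiv k H).apply_symm_apply
  refine antipode_injective (k := k) ?_
  rw [map_sum, map_smul, antipode_one, ← sum_mul_antipode_eq_smul r]
  simp only [antipode_mul_antidistrib, hS]

end Antipode

/-! ### Stable left ideals of `Q*` and the counit as a translate -/

namespace GenQuot

universe u v

variable {k : Type u} {H : Type v} [Field k] [Ring H] [HopfAlgebra k H] [FiniteDimensional k H]
  (Q : GenQuot k H)

/-- Here `L` is only a left ideal, so `c₂ S⁻¹(c₁) = ε(c)` replaces the antipode identity used for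
two-sided ideals. Contractions on the left commute with those by `L`, which reduces the claim to
`ε(c) = 0`. -/
theorem eq_zero_of_contractRight_eq_zero {L : Ideal Q.dualAlg}
    (hL : ∀ p, ∀ u ∈ L, Q.dualModuleAlg.act p u ∈ L) (hne : L ≠ ⊥) {c : H}
    (hc : ∀ u ∈ L, contractRight u.1.ofConv c = 0) : c = 0 := by
  have hcounit : ∀ c : H, (∀ u ∈ L, contractRight u.1.ofConv c = 0) →
      counit (R := k) c = 0 := by
    intro c hc
    by_contra h0
    refine hne ((Submodule.eq_bot_iff _).mpr fun u hu => dualAlg_ext fun g => ?_)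
    have h := congrArg (fun x => u.1 (x * g))
      (sum_mul_antipodeEquiv_symm (reprBasisLeft (Module.finBasis k H) c))
    simp only [Finset.sum_mul, map_sum, smul_mul_assoc, one_mul, map_smul] at h
    rw [Finset.sum_eq_zero] at h
    · exact (smul_eq_zero.mp h.symm).resolve_left h0
    · intro i _
      have h1 := hc _ (hL ((antipodeEquiv k H).symm (Module.finBasis k H i) * g) u hu)
      have h2 := apply_contractLeft
        (Q.dualModuleAlg.act ((antipodeEquiv k H).symm (Module.finBasis k H i) * g) u).1.ofConv
        ((Module.finBasis k H).coord i) c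
      rw [h1, map_zero] at h2
      rw [mul_assoc]
      exact h2
  refine (Module.forall_dual_apply_eq_zero_iff k c).mp fun l => ?_
  rw [← counit_contractLeft]
  refine hcounit _ fun u hu => ?_
  rw [contractRight_contractLeft, hc u hu, map_zero]

/-- The left action `u ↦ (x ↦ ∑ u(x₂) x₁)` of `Q*` on `H`. -/
noncomputable def hit : Q.dualAlg →ₐ[k] Module.End k H :=
  AlgHom.ofLinearMap
    { toFun := fun u => contractRight u.1.ofConv
      map_add' := fun u v => by
        ext x
        simp [contractRight]
      map_smul' := fun a u => by
        ext x
        simp [contractRight] }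
    (by
      ext x
      exact contractRight_counit x)
    (fun u v => by
      ext x
      exact contractRight_mul u.1 v.1 x)

/-- Let `Q*` act on `H` by contraction, twisted by right multiplication. A proper `L` would kill
some nonzero `x ∈ H`, while a nonzero stable left ideal kills none. -/
theorem eq_top_of_stable {L : Ideal Q.dualAlg}
    (hL : ∀ p, ∀ u ∈ L, Q.dualModuleAlg.act p u ∈ L) (hne : L ≠ ⊥) : L = ⊤ := by
  by_contra htop
  have : Nontrivial H := Bialgebra.nontrivial (R := k)
  let _ : Module Q.dualAlg H := Module.compHom H Q.hit.toRingHom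
  have hsmul : ∀ (u : Q.dualAlg) (x : H), u • x = contractRight u.1.ofConv x := fun _ _ => rfl
  have : IsScalarTower k Q.dualAlg H := ⟨fun a u x => by
    change Q.hit (a • u) x = a • Q.hit u x
    rw [map_smul, LinearMap.smul_apply]⟩
  have hσ : ∀ (u : Q.dualAlg) (p x : H), u • (LinearMap.mul k H).flip p x =
      ∑ i ∈ (ℛ k p).index, (LinearMap.mul k H).flip ((ℛ k p).left i)
        (Q.dualModuleAlg.act ((ℛ k p).right i) u • x) := by
    intro u p x
    simp only [LinearMap.flip_apply, LinearMap.mul_apply', hsmul]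
    rw [contractRight_apply _ ((ℛ k x).mul (ℛ k p))]
    simp only [contractRight_apply _ (ℛ k x), Finset.sum_mul, smul_mul_assoc]
    rw [Finset.sum_comm]
    exact Finset.sum_product _ _ _
  have hinj : Function.Injective (ModuleAlg.twistMap (LinearMap.mul k H).flip) := by
    refine twistMap_injective _ ((LinearMap.mul k H).flip ∘ₗ antipode k) fun p => ?_
    ext x
    simp only [LinearMap.sum_apply, Module.End.mul_apply, LinearMap.comp_apply,
      LinearMap.flip_apply, LinearMap.mul_apply', mul_assoc, ← Finset.mul_sum]
    rw [sum_mul_antipode_eq_smul]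
    simp
  obtain ⟨x, hx, h⟩ := ModuleAlg.exists_ne_zero_forall_smul_eq_zero.{u, v} Q.dualModuleAlg
    hσ hinj (fun P hP hne c hc => Q.eq_zero_of_contractRight_eq_zero hP.act_mem hne hc) L htop
  exact hx (Q.eq_zero_of_contractRight_eq_zero hL hne h)

/-- The dual of a generalised quotient `Q` contains a left integral `t` some translate of which is
the counit. -/
theorem exists_integral_translate_eq_counit :
    ∃ t : Q.dualAlg, Q.IsIntegral t ∧ ∃ h : H, ∀ x, t.1 (x * antipode k h) = counit (R := k) x := by
  obtain ⟨t, ht, hint⟩ := Q.exists_isIntegral fun P hP hne n hn => by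
    have h : (1 : Q.dualAlg) ∈ P := Q.eq_top_of_stable hP.act_mem hne ▸ Submodule.mem_top
    simpa using hn 1 h
  let L : Ideal Q.dualAlg :=
    { carrier := {u | ∃ h, Q.dualModuleAlg.actAntipode h t = u}
      add_mem' := by
        rintro _ _ ⟨h, rfl⟩ ⟨g, rfl⟩
        exact ⟨h + g, by rw [map_add, LinearMap.add_apply]⟩
      zero_mem' := ⟨0, by rw [map_zero, LinearMap.zero_apply]⟩
      smul_mem' := by
        rintro u _ ⟨h, rfl⟩
        refine ⟨contractRight u.1.ofConv h, ?_⟩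
        rw [smul_eq_mul, hint.mul_act, contractRight_apply _ (ℛ k h), map_sum,
          LinearMap.sum_apply]
        simp only [map_smul, LinearMap.smul_apply] }
  have hL : ∀ p, ∀ u ∈ L, Q.dualModuleAlg.act p u ∈ L := by
    rintro p _ ⟨h, rfl⟩
    -- Surjectivity of the antipode is what makes the set of translates `S(h) t` stable under all of
    -- `H`.
    obtain ⟨q, rfl⟩ := antipode_surjective (k := k) p
    refine ⟨h * q, ?_⟩
    simp only [ModuleAlg.actAntipode_apply, antipode_mul_antidistrib, map_mul,
      Module.End.mul_apply]
  have hne : L ≠ ⊥ := by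
    intro h
    have h1 : t ∈ L := ⟨1, by simp⟩
    exact ht (by simpa [h] using h1)
  have h1 : (1 : Q.dualAlg) ∈ L := Q.eq_top_of_stable hL hne ▸ Submodule.mem_top
  obtain ⟨h, hh⟩ := h1
  exact ⟨t, hint, h, fun x => congrArg (fun u : Q.dualAlg => u.1 x) hh⟩

end GenQuot

theorem eq_zero_of_forall_rTensor {k V W : Type*} [Field k] [AddCommGroup V] [Module k V]
    [AddCommGroup W] [Module k W] {z : V ⊗[k] W}
    (h : ∀ f : V →ₗ[k] k, TensorProduct.lid k W (f.rTensor W z) = 0) : z = 0 := by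
  classical
  let b := Module.Free.chooseBasis k V
  obtain ⟨c, rfl⟩ := TensorProduct.eq_repr_basis_left b z
  have hc : ∀ i, c i = 0 := by
    intro i
    have h' := h (b.coord i)
    simpa [Finsupp.sum, Finsupp.single_apply] using h'
  simp [Finsupp.sum, hc]

namespace GenQuot

variable {k H : Type*} [Field k] [Ring H] [HopfAlgebra k H] {Q : GenQuot k H}

theorem proj_contractRight {t : Q.dualAlg} (ht : Q.IsIntegral t) :
    Q.proj ∘ₗ contractRight t.1.ofConv = t.1.ofConv.smulRight (Q.proj 1) := by
  ext x
  refine sub_eq_zero.mp ((Module.forall_dual_apply_eq_zero_iff k _).mp fun l => ?_)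
  let u : Q.dualAlg := ⟨toConv (l ∘ₗ Q.proj), fun y hy => by
    change l (Q.ker.mkQ y) = 0
    rw [Submodule.mkQ_apply, (Submodule.Quotient.mk_eq_zero _).mpr hy, map_zero]⟩
  have h := congrArg (fun v : Q.dualAlg => v.1 x) (ht u)
  have h' : l (Q.proj (contractRight t.1.ofConv x)) = l (Q.proj 1) * t.1 x :=
    (apply_contractRight (l ∘ₗ Q.proj) t.1.ofConv x).trans h
  simp only [LinearMap.comp_apply, LinearMap.smulRight_apply, map_sub, map_smul, smul_eq_mul]
  rw [h', mul_comm, sub_self]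

end GenQuot

/-! ### Injectivity of `can_Q` from the integral -/

namespace ComoduleAlgebra

variable {k H A : Type*} [Field k] [Ring H] [HopfAlgebra k H] [Ring A] [Algebra k A]
  (δ : ComoduleAlgebra k H A)

/-- The map `a ↦ a₀ l(a₁)`. -/
noncomputable def coactContract (l : H →ₗ[k] k) : A →ₗ[k] A :=
  (TensorProduct.rid k A).toLinearMap ∘ₗ l.lTensor A ∘ₗ δ.coact.toLinearMap

theorem coact_coactContract (l : H →ₗ[k] k) (a : A) :
    δ.coact (δ.coactContract l a) = (contractRight l).lTensor A (δ.coact a) := by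
  let F : A ⊗[k] (H ⊗[k] H) →ₗ[k] A ⊗[k] H :=
    ((TensorProduct.rid k H).toLinearMap ∘ₗ l.lTensor H).lTensor A
  have hF : F ∘ₗ (TensorProduct.assoc k A H H).toLinearMap ∘ₗ δ.coact.toLinearMap.rTensor H =
      δ.coact.toLinearMap ∘ₗ (TensorProduct.rid k A).toLinearMap ∘ₗ l.lTensor A := by
    ext c h
    have hx : ∀ x : A ⊗[k] H, F (TensorProduct.assoc k A H H (x ⊗ₜ h)) = l h • x := by
      intro x
      induction x with
      | zero => simp
      | add x y hx hy => rw [TensorProduct.add_tmul, map_add, map_add, hx, hy, smul_add]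
      | tmul x y => simp [F]
    simpa using hx (δ.coact c)
  have h₁ := LinearMap.congr_fun hF (δ.coact a)
  have h₂ := congrArg F (LinearMap.congr_fun δ.coassoc a)
  simp only [LinearMap.comp_apply] at h₁ h₂
  refine h₁.symm.trans (h₂.trans ?_)
  rw [← LinearMap.comp_apply, ← LinearMap.lTensor_comp]
  rfl

/-- Coassociativity moves the contraction into the `H`-factor, where the integral satisfies `π(x₁)
t(x₂) = t(x) π(1)`. -/
theorem coactContract_mem {Q : GenQuot k H} {t : Q.dualAlg} (ht : Q.IsIntegral t) (a : A) :
    δ.coactContract t.1.ofConv a ∈ δ.coinvQuot Q := by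
  rw [mem_coinvQuot]
  simp only [coactQuot, LinearMap.comp_apply, AlgHom.toLinearMap_apply]
  rw [coact_coactContract, ← LinearMap.comp_apply, ← LinearMap.lTensor_comp,
    GenQuot.proj_contractRight ht]
  simp only [coactContract, LinearMap.comp_apply, AlgHom.toLinearMap_apply]
  generalize δ.coact a = x
  induction x with
  | zero => simp
  | add x y hx hy => simp only [map_add, hx, hy, TensorProduct.add_tmul]
  | tmul x y => simp [TensorProduct.smul_tmul]

/-- The map `a ⊗ h ↦ a₀ ⊗ a₁ S(h)`, which intertwines the two canonical maps. -/
noncomputable def canTwist : A ⊗[k] H →ₗ[k] A ⊗[k] H :=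
  LinearMap.mul' k (A ⊗[k] H) ∘ₗ TensorProduct.map δ.coact.toLinearMap
    ((Algebra.TensorProduct.includeRight (R := k) (A := A) (B := H)).toLinearMap ∘ₗ antipode k)

@[simp] theorem canTwist_tmul (a : A) (h : H) :
    δ.canTwist (a ⊗ₜ h) = δ.coact a * ((1 : A) ⊗ₜ[k] antipode k h) := rfl

theorem canTwist_tmul_one_mul (a : A) (x : A ⊗[k] H) :
    δ.canTwist ((a ⊗ₜ[k] (1 : H)) * x) = δ.coact a * δ.canTwist x := by
  induction x with
  | zero => simp
  | add x y hx hy => rw [mul_add, map_add, map_add, hx, hy, mul_add]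
  | tmul x y => simp [mul_assoc]

theorem canTwist_coact (b : A) : δ.canTwist (δ.coact b) = b ⊗ₜ[k] (1 : H) := by
  let F : A ⊗[k] (H ⊗[k] H) →ₗ[k] A ⊗[k] H :=
    (LinearMap.mul' k H ∘ₗ (antipode k).lTensor H).lTensor A
  have hF : F ∘ₗ (TensorProduct.assoc k A H H).toLinearMap ∘ₗ δ.coact.toLinearMap.rTensor H =
      δ.canTwist := by
    ext c h
    have hx : ∀ x : A ⊗[k] H, F (TensorProduct.assoc k A H H (x ⊗ₜ h)) =
        x * ((1 : A) ⊗ₜ[k] antipode k h) := by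
      intro x
      induction x with
      | zero => simp
      | add x y hx hy => rw [TensorProduct.add_tmul, map_add, map_add, hx, hy, add_mul]
      | tmul x y => simp [F]
    simpa using hx (δ.coact c)
  have h₁ := LinearMap.congr_fun hF (δ.coact b)
  have h₂ := congrArg F (LinearMap.congr_fun δ.coassoc b)
  simp only [LinearMap.comp_apply] at h₁ h₂
  refine h₁.symm.trans (h₂.trans ?_)
  rw [← LinearMap.comp_apply, ← LinearMap.lTensor_comp, LinearMap.comp_assoc,
    mul_antipode_lTensor_comul, LinearMap.lTensor_comp, LinearMap.comp_apply]
  have h₃ := LinearMap.congr_fun δ.counital b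
  simp only [LinearMap.comp_apply, LinearMap.id_apply] at h₃
  have h₄ : (counit (R := k) (A := H)).lTensor A (δ.coact.toLinearMap b) = b ⊗ₜ 1 :=
    (TensorProduct.rid k A).injective (by
      rw [TensorProduct.rid_tmul, one_smul]
      exact h₃)
  rw [h₄]
  simp

theorem canTwist_preCan (a b : A) :
    δ.canTwist (δ.preCan (a ⊗ₜ b)) = δ.coact a * (b ⊗ₜ[k] (1 : H)) := by
  rw [preCan_tmul, canTwist_tmul_one_mul, canTwist_coact]

theorem rid_lTensor_mul_tmul_one (l : H →ₗ[k] k) (x : A ⊗[k] H) (b : A) :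
    TensorProduct.rid k A (l.lTensor A (x * (b ⊗ₜ[k] (1 : H)))) =
      TensorProduct.rid k A (l.lTensor A x) * b := by
  induction x with
  | zero => simp
  | add x y hx hy => simp only [add_mul, map_add, hx, hy]
  | tmul x y => simp

theorem rid_lTensor_tmul_one_mul (l : H →ₗ[k] k) (x : A ⊗[k] H) (b : A) :
    TensorProduct.rid k A (l.lTensor A ((b ⊗ₜ[k] (1 : H)) * x)) =
      b * TensorProduct.rid k A (l.lTensor A x) := by
  induction x with
  | zero => simp
  | add x y hx hy => simp only [mul_add, map_add, hx, hy]
  | tmul x y => simp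

/-- Applying `canTwist` to `hs` gives `∑ δ(xᵢ)(yᵢ ⊗ 1) = 1 ⊗ S(h)`. Multiply by `δ(y)` on the left
and apply `t`: the right side becomes `y₀ t(y₁ S(h)) = y`. -/
theorem sum_coactContract_mul {t : H →ₗ[k] k} {h : H}
    (ht : ∀ x, t (x * antipode k h) = counit (R := k) x) {s : Finset (A × A)}
    (hs : δ.preCan (∑ i ∈ s, i.1 ⊗ₜ i.2) = (1 : A) ⊗ₜ h) (y : A) :
    ∑ i ∈ s, δ.coactContract t (y * i.1) * i.2 = y := by
  have h₁ := congrArg (fun x => TensorProduct.rid k A (t.lTensor A (δ.coact y * δ.canTwist x))) hs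
  simp only [map_sum, canTwist_preCan, Finset.mul_sum, ← mul_assoc, ← map_mul,
    rid_lTensor_mul_tmul_one, canTwist_tmul, map_one, one_mul] at h₁
  refine h₁.trans ?_
  have h₂ := LinearMap.congr_fun δ.counital y
  simp only [LinearMap.comp_apply, LinearMap.id_apply] at h₂
  refine Eq.trans ?_ h₂
  simp only [AlgHom.toLinearMap_apply, LinearEquiv.coe_coe]
  generalize δ.coact y = x
  induction x with
  | zero => simp
  | add x y hx hy => simp only [add_mul, map_add, hx, hy]
  | tmul x y => simp [ht]

variable {δ} in
theorem IsHopfGalois.preCan_surjective (hδ : δ.IsHopfGalois) : Function.Surjective δ.preCan := by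
  intro x
  obtain ⟨z, rfl⟩ := hδ.2 x
  obtain ⟨z, rfl⟩ := Submodule.mkQ_surjective _ z
  exact ⟨z, rfl⟩

theorem mkQ_tmul_mul (B : Subalgebra k A) (a c : A) {b : A} (hb : b ∈ B) :
    (balancedRel B).mkQ ((a * b) ⊗ₜ c) = (balancedRel B).mkQ (a ⊗ₜ (b * c)) := by
  rw [← sub_eq_zero, ← map_sub, Submodule.mkQ_apply, Submodule.Quotient.mk_eq_zero]
  exact Submodule.subset_span ⟨a, c, b, hb, rfl⟩

variable {δ} in
theorem IsHopfGalois.ker_le_balancedRel [FiniteDimensional k H] (hδ : δ.IsHopfGalois)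
    (Q : GenQuot k H) :
    LinearMap.ker (Q.proj.lTensor A ∘ₗ δ.preCan) ≤ balancedRel (δ.coinvQuot Q) := by
  obtain ⟨t, hint, h, ht⟩ := Q.exists_integral_translate_eq_counit
  obtain ⟨w, hw⟩ := hδ.preCan_surjective ((1 : A) ⊗ₜ h)
  obtain ⟨s, rfl⟩ := TensorProduct.exists_finset w
  intro z hz
  let G : A → A ⊗[k] H →ₗ[k] A := fun a => (TensorProduct.rid k A).toLinearMap ∘ₗ
    t.1.ofConv.lTensor A ∘ₗ LinearMap.mulRight k (δ.coact a)
  have hG : ∀ z, (balancedRel (δ.coinvQuot Q)).mkQ z =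
      (balancedRel (δ.coinvQuot Q)).mkQ (∑ i ∈ s, G i.1 (δ.preCan z) ⊗ₜ i.2) := by
    intro z
    induction z with
    | zero => simp
    | add x y hx hy =>
      rw [map_add, hx, hy]
      simp only [map_add, TensorProduct.add_tmul, Finset.sum_add_distrib]
    | tmul x y =>
      have hGi : ∀ a, G a (δ.preCan (x ⊗ₜ y)) = x * δ.coactContract t.1.ofConv (y * a) := by
        intro a
        simp only [G, LinearMap.comp_apply, LinearMap.mulRight_apply, preCan_tmul, mul_assoc,
          ← map_mul, LinearEquiv.coe_coe, rid_lTensor_tmul_one_mul]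
        rfl
      simp only [hGi, map_sum, mkQ_tmul_mul _ _ _ (δ.coactContract_mem hint _)]
      rw [← map_sum, ← TensorProduct.tmul_sum, δ.sum_coactContract_mul ht hw]
  -- Right multiplication by `δ(a)` preserves the kernel of `id ⊗ π`, and `t` factors through `π`.
  have h0 : ∀ a, G a (δ.preCan z) = 0 := by
    intro a
    have h₁ : Q.proj.lTensor A (δ.preCan z * δ.coact a) = 0 := by
      have h₂ := lTensor_proj_mul_congr Q (x := δ.preCan z) (y := 0)
        (by rw [map_zero]; exact hz) (δ.coact a)
      rwa [zero_mul, map_zero] at h₂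
    have h₃ : Q.ker.liftQ t.1.ofConv t.2 ∘ₗ Q.proj = t.1.ofConv := Submodule.liftQ_mkQ _ _ _
    simp only [G, LinearMap.comp_apply, LinearMap.mulRight_apply]
    rw [← h₃, LinearMap.lTensor_comp, LinearMap.comp_apply, h₁, map_zero, map_zero]
  rw [← Submodule.Quotient.mk_eq_zero, ← Submodule.mkQ_apply, hG z]
  simp [h0]

variable {δ} in
theorem IsHopfGalois.isQuotGalois [FiniteDimensional k H] (hδ : δ.IsHopfGalois)
    (Q : GenQuot k H) : δ.IsQuotGalois Q := by
  refine ⟨LinearMap.ker_eq_bot.mp (Submodule.ker_liftQ_eq_bot _ _ _ (hδ.ker_le_balancedRel Q)), ?_⟩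
  intro x
  obtain ⟨y, rfl⟩ := LinearMap.lTensor_surjective A Q.ker.mkQ_surjective x
  obtain ⟨z, rfl⟩ := hδ.preCan_surjective y
  exact ⟨(balancedRel (δ.coinvQuot Q)).mkQ z, rfl⟩

variable {δ} in
-- For `x` in the kernel of `H → Q`, lift `1 ⊗ x` along `can`. The lift lies in the relations of
-- `A^{co Q}`, hence in those of `A^{co Q'}`, so `1 ⊗ π'(x) = 0`; as `A ≠ 0`, this gives `π'(x) =
-- 0`.
theorem IsHopfGalois.le_of_coinvQuot_le [FiniteDimensional k H] [Nontrivial A]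
    (hδ : δ.IsHopfGalois) {Q Q' : GenQuot k H} (h : δ.coinvQuot Q ≤ δ.coinvQuot Q') :
    Q' ≤ Q := by
  intro x hx
  obtain ⟨z, hz⟩ := hδ.preCan_surjective ((1 : A) ⊗ₜ x)
  have h₁ : z ∈ balancedRel (δ.coinvQuot Q) := by
    refine hδ.ker_le_balancedRel Q ?_
    rw [LinearMap.mem_ker, LinearMap.comp_apply, hz, LinearMap.lTensor_tmul, Submodule.mkQ_apply,
      (Submodule.Quotient.mk_eq_zero _).mpr hx, TensorProduct.tmul_zero]
  have h₂ : z ∈ balancedRel (δ.coinvQuot Q') := by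
    refine Submodule.span_mono ?_ h₁
    rintro _ ⟨a, c, b, hb, rfl⟩
    exact ⟨a, c, b, h hb, rfl⟩
  have h₃ : Q'.proj.lTensor A (δ.preCan z) = 0 := by
    have h₄ := congrArg (δ.canQuot Q') ((Submodule.Quotient.mk_eq_zero _).mpr h₂)
    rwa [map_zero] at h₄
  rw [hz, LinearMap.lTensor_tmul] at h₃
  obtain ⟨l, hl⟩ := Module.Projective.exists_dual_ne_zero k (one_ne_zero (α := A))
  have h₄ := congrArg (fun z => TensorProduct.lid k _ (l.rTensor _ z)) h₃
  simp only [LinearMap.rTensor_tmul, TensorProduct.lid_tmul, map_zero] at h₄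
  exact (Submodule.Quotient.mk_eq_zero _).mp ((smul_eq_zero.mp h₄).resolve_left hl)

/-! ### The adjoint `ψ` and the Galois connection -/

/-- The element `f(a₀) a₁` of `H`. -/
noncomputable def coeff (f : A →ₗ[k] k) : A →ₗ[k] H :=
  (TensorProduct.lid k H).toLinearMap ∘ₗ f.rTensor H ∘ₗ δ.coact.toLinearMap

theorem lid_rTensor_lTensor_mul {V : Type*} [AddCommGroup V] [Module k V] (p : H →ₗ[k] V)
    (f : A →ₗ[k] k) (x : A ⊗[k] H) (h : H) :
    TensorProduct.lid k V (f.rTensor V (p.lTensor A (x * ((1 : A) ⊗ₜ h)))) =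
      p (TensorProduct.lid k H (f.rTensor H x) * h) := by
  induction x with
  | zero => simp
  | add x y hx hy => simp only [add_mul, map_add, hx, hy]
  | tmul x y => simp

theorem lTensor_coact_mul_eq {V : Type*} [AddCommGroup V] [Module k V] {p : H →ₗ[k] V} {a : A}
    {h : H} : p.lTensor A (δ.coact a * ((1 : A) ⊗ₜ h)) = a ⊗ₜ[k] p h ↔
      ∀ f : A →ₗ[k] k, p (δ.coeff f a * h - f a • h) = 0 := by
  have key : ∀ f : A →ₗ[k] k, TensorProduct.lid k V (f.rTensor V
      (p.lTensor A (δ.coact a * ((1 : A) ⊗ₜ h)) - a ⊗ₜ[k] p h)) =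
      p (δ.coeff f a * h - f a • h) := by
    intro f
    rw [map_sub, map_sub, lid_rTensor_lTensor_mul, map_sub]
    simp [coeff]
  rw [← sub_eq_zero]
  constructor
  · intro h0 f
    rw [← key, h0, map_zero, map_zero]
  · intro h0
    exact eq_zero_of_forall_rTensor fun f => (key f).trans (h0 f)

/-- The right ideal of `H` generated by all `f(a₀) a₁ - f(a)` with `a ∈ S`. -/
def coeffIdeal (S : Subalgebra k A) : Submodule k H :=
  Submodule.span k {x | ∃ a ∈ S, ∃ (f : A →ₗ[k] k) (h : H), x = δ.coeff f a * h - f a • h}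

theorem counit_coeff (f : A →ₗ[k] k) (a : A) : counit (R := k) (δ.coeff f a) = f a := by
  have h := congrArg f (LinearMap.congr_fun δ.counital a)
  simp only [LinearMap.comp_apply, LinearMap.id_apply, AlgHom.toLinearMap_apply,
    LinearEquiv.coe_coe] at h
  rw [← h]
  simp only [coeff, LinearMap.comp_apply, AlgHom.toLinearMap_apply, LinearEquiv.coe_coe]
  generalize δ.coact a = x
  induction x with
  | zero => simp
  | add x y hx hy => simp only [map_add, hx, hy]
  | tmul x y => simp [mul_comm]

/-- Since `Δ(f(a₀) a₁) = f(a₀) a₁ ⊗ a₂`, the right factor can be isolated as `δ(a)(1 ⊗ h)`, where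
coinvariance of `a` modulo the ideal applies. -/
theorem comul_coeff_mul {V : Type*} [AddCommGroup V] [Module k V] (p : H →ₗ[k] V)
    (f : A →ₗ[k] k) (a : A) (g h : H) :
    TensorProduct.map p p (comul (R := k) (δ.coeff f a) * (g ⊗ₜ[k] h)) =
      (p ∘ₗ LinearMap.mulRight k g ∘ₗ δ.coeff f).rTensor V
        (p.lTensor A (δ.coact a * ((1 : A) ⊗ₜ h))) := by
  let F : A ⊗[k] (H ⊗[k] H) →ₗ[k] H ⊗[k] H :=
    (TensorProduct.lid k (H ⊗[k] H)).toLinearMap ∘ₗ f.rTensor (H ⊗[k] H)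
  have h₁ : comul (R := k) (δ.coeff f a) =
      F (TensorProduct.assoc k A H H (δ.coact.toLinearMap.rTensor H (δ.coact a))) := by
    have h₂ := congrArg F (LinearMap.congr_fun δ.coassoc a)
    refine Eq.trans ?_ h₂.symm
    simp only [coeff, LinearMap.comp_apply, AlgHom.toLinearMap_apply, LinearEquiv.coe_coe, F]
    generalize δ.coact a = x
    induction x with
    | zero => simp
    | add x y hx hy => simp only [map_add, hx, hy]
    | tmul x y => simp
  rw [h₁]
  generalize δ.coact a = x
  induction x with
  | zero => simp
  | add x y hx hy => simp only [map_add, add_mul, hx, hy]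
  | tmul c q =>
    have hF : ∀ y : A ⊗[k] H, F (TensorProduct.assoc k A H H (y ⊗ₜ q)) =
        TensorProduct.lid k H (f.rTensor H y) ⊗ₜ q := by
      intro y
      induction y with
      | zero => simp
      | add x y hx hy => simp only [TensorProduct.add_tmul, map_add, hx, hy]
      | tmul x y => simp [F, TensorProduct.smul_tmul']
    rw [LinearMap.rTensor_tmul, hF]
    simp [coeff]

/-- The quotient of `H` by the right ideal generated by all `f(a₀) a₁ - f(a)` with `a ∈ S`. -/
def coeffQuot (S : Subalgebra k A) : GenQuot k H where
  ker := δ.coeffIdeal S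
  isCoideal := by
    have hmem : ∀ a ∈ S, ∀ (f : A →ₗ[k] k) (h : H),
        (δ.coeffIdeal S).mkQ (δ.coeff f a * h - f a • h) = 0 := fun a ha f h =>
      (Submodule.Quotient.mk_eq_zero _).mpr (Submodule.subset_span ⟨a, ha, f, h, rfl⟩)
    constructor
    · intro x hx
      induction hx using Submodule.span_induction with
      | zero => simp
      | add x y _ _ hx hy => rw [map_add, hx, hy, add_zero]
      | smul c x _ hx => rw [map_smul, hx, smul_zero]
      | mem x hx =>
        obtain ⟨a, -, f, h, rfl⟩ := hx
        rw [map_sub, map_smul, Bialgebra.counit_mul, counit_coeff, smul_eq_mul, sub_self]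
    · intro x hx
      induction hx using Submodule.span_induction with
      | zero => simp
      | add x y _ _ hx hy => rw [map_add, map_add, hx, hy, add_zero]
      | smul c x _ hx => rw [map_smul, map_smul, hx, smul_zero]
      | mem x hx =>
        obtain ⟨a, ha, f, h, rfl⟩ := hx
        rw [map_sub, map_sub, map_smul, map_smul, Bialgebra.comul_mul, sub_eq_zero]
        generalize comul (R := k) h = y
        induction y with
        | zero => simp
        | add x y hx hy => simp only [mul_add, map_add, hx, hy, smul_add]
        | tmul g h =>
          rw [comul_coeff_mul, δ.lTensor_coact_mul_eq.mpr fun f => hmem a ha f h,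
            LinearMap.rTensor_tmul, TensorProduct.map_tmul]
          have h₁ := hmem a ha f g
          rw [map_sub, sub_eq_zero, map_smul] at h₁
          simp only [LinearMap.comp_apply, LinearMap.mulRight_apply]
          rw [h₁, TensorProduct.smul_tmul']
  mul_mem := by
    intro x hx g
    induction hx using Submodule.span_induction with
    | zero => simp
    | add x y _ _ hx hy => rw [add_mul]; exact add_mem hx hy
    | smul c x _ hx => rw [smul_mul_assoc]; exact Submodule.smul_mem _ c hx
    | mem x hx =>
      obtain ⟨a, ha, f, h, rfl⟩ := hx
      exact Submodule.subset_span ⟨a, ha, f, h * g, by rw [sub_mul, mul_assoc, smul_mul_assoc]⟩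

theorem le_coinvQuot_iff {S : Subalgebra k A} {Q : GenQuot k H} :
    S ≤ δ.coinvQuot Q ↔ Q ≤ δ.coeffQuot S := by
  constructor
  · intro hS
    change Submodule.span k _ ≤ Q.ker
    rw [Submodule.span_le]
    rintro _ ⟨a, ha, f, h, rfl⟩
    refine (Submodule.Quotient.mk_eq_zero _).mp
      ((δ.lTensor_coact_mul_eq (p := Q.proj)).mp ?_ f)
    have h₁ : Q.proj.lTensor A (δ.coact a) = Q.proj.lTensor A (a ⊗ₜ[k] (1 : H)) := by
      simpa [coactQuot] using (δ.mem_coinvQuot Q).mp (hS ha)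
    simpa using lTensor_proj_mul_congr Q h₁ ((1 : A) ⊗ₜ h)
  · intro hQ a ha
    rw [mem_coinvQuot]
    have h₁ := (δ.lTensor_coact_mul_eq (p := Q.proj) (a := a) (h := 1)).mpr fun f =>
      (Submodule.Quotient.mk_eq_zero _).mpr (hQ (Submodule.subset_span ⟨a, ha, f, 1, rfl⟩))
    rwa [← Algebra.TensorProduct.one_def, mul_one] at h₁

end ComoduleAlgebra

end HopfGalois

/-- Finite Hopf–Galois theory. The second part says that the Galois connection `(φ, ψ)` between
`Quot_gen(H)` and `Sub_alg(A / A^{co H})`, with `φ(Q) = A^{co Q}`, exists and restricts to an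
anti-isomorphism between `Quot_gen(H)` and the poset of intermediate `H`-extensions. -/
theorem mainTheorem4 {k H A : Type*} [Field k] [Ring H] [HopfAlgebra k H]
    [FiniteDimensional k H] [Ring A] [Nontrivial A] [Algebra k A]
    (δ : HopfGalois.ComoduleAlgebra k H A) (hδ : δ.IsHopfGalois) :
    (∀ Q : HopfGalois.GenQuot k H, δ.IsQuotGalois Q) ∧
    ∃ ψ : δ.SubAlg → HopfGalois.GenQuot k H,
      GaloisConnection (OrderDual.toDual ∘ δ.phi) (ψ ∘ OrderDual.ofDual) ∧
      ∃ e : HopfGalois.GenQuot k H ≃o (δ.SubHExt)ᵒᵈ,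
        (∀ Q : HopfGalois.GenQuot k H, (OrderDual.ofDual (e Q)).1 = δ.phi Q) ∧
        ∀ S : δ.SubHExt, e.symm (OrderDual.toDual S) = ψ S.1 := by
  have hgc : GaloisConnection (OrderDual.toDual ∘ δ.phi)
      ((fun S : δ.SubAlg => δ.coeffQuot S.1) ∘ OrderDual.ofDual) :=
    fun Q S => δ.le_coinvQuot_iff (S := (OrderDual.ofDual S).1) (Q := Q)
  -- The unit `φ(Q) ⊆ φ(ψ(φ(Q)))` gives `ψ(φ(Q)) ≤ Q` because `φ` reflects the order.
  have hinv : ∀ Q, δ.coeffQuot (δ.phi Q).1 = Q := fun Q =>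
    le_antisymm (hδ.le_of_coinvQuot_le (δ.le_coinvQuot_iff.mpr le_rfl))
      (δ.le_coinvQuot_iff.mp le_rfl)
  refine ⟨hδ.isQuotGalois, fun S => δ.coeffQuot S.1, hgc, ?_⟩
  refine ⟨{ toFun := fun Q => OrderDual.toDual ⟨δ.phi Q, Q, rfl⟩
            invFun := fun S => δ.coeffQuot (OrderDual.ofDual S).1.1
            left_inv := hinv
            right_inv := ?_
            map_rel_iff' := ?_ }, fun _ => rfl, fun _ => rfl⟩
  · rintro ⟨S, Q, hS⟩
    obtain rfl : S = δ.phi Q := Subtype.ext hS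
    exact congrArg OrderDual.toDual (Subtype.ext (congrArg δ.phi (hinv Q)))
  · intro Q Q'
    exact ⟨fun h => hδ.le_of_coinvQuot_le h, fun h => hgc.monotone_l h⟩
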